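/- Let $N\ge 2$, $d\ge N+2$, and let $w_1\ge w_2\ge w_3\ge 0$ with $w_1+w_2+w_3=1$; put $\boldsymbol w=(w_1,w_2,w_3,0,\ldots)$. Let $\mathcal E^N(\boldsymbol w)$ be the set of density operators on the $N$-fermion space $\wedge^N\mathbb C^d$ with decreasingly ordered spectrum $\boldsymbol w$, let $\overline{\mathcal E}^1_N(\boldsymbol w)=\mathrm{conv}\{N\,\mathrm{Tr}_{N-1}[\Gamma]:\Gamma\in\mathcal E^N(\boldsymbol w)\}$ be the convex hull of the set of their one-particle reduced density matrices, and let $\Sigma(\boldsymbol w)\subset\mathbb R^d$ be the set of all vectors $\boldsymbol\lambda=(\lambda_1,\ldots,\lambda_d)$ of eigenvalues (with multiplicity, in any order) of elements of $\overline{\mathcal E}^1_N(\boldsymbol w)$. Let $\lambda^\downarrow_1\ge\dots\ge\lambda^\downarrow_d$ be the decreasing rearrangement of $\boldsymbol\lambda$, and let $$\boldsymbol v^{(1)}=(\underbrace{1,\ldots,1}_{N-1},w_1,w_2,w_3,0,\ldots,0),\qquad \boldsymbol v^{(2)}=(\underbrace{1,\ldots,1}_{N-2},w_1+w_2,w_1+w_3,w_2+w_3,0,\ldots,0)\in\mathbb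 R^d.$$ (a) Vertex representation. $\Sigma(\boldsymbol w)$ is the convex hull of all permutations of $\boldsymbol v^{(1)}$ and $\boldsymbol v^{(2)}$. Its extreme points are exactly these permutations, and if $w_3>0$ then $\boldsymbol v^{(1)}$ and $\boldsymbol v^{(2)}$ are not permutations of each other. (b) Origin of the two vertices. For $h_1\le\dots\le h_d$, give a configuration $\boldsymbol i=(i_1<\dots<i_N)$, $i_k\in\{1,\dots,d\}$, the energy $\sum_k h_{i_k}$. Let $\boldsymbol i_1=(1,\ldots,N)$, $\boldsymbol i_2=(1,\ldots,N-1,N+1)$, $\boldsymbol a=(1,\ldots,N-1,N+2)$, $\boldsymbol b=(1,\ldots,N-2,N,N+1)$. If $\boldsymbol a$ has energy at most that of $\boldsymbol b$, then $\boldsymbol i_1,\boldsymbol i_2,\boldsymbol a$ is a sequence of three energetically lowest configurations in order of increasing energy; if $\boldsymbol b$ has energy at most that of $\boldsymbol a$, then $\boldsymbol i_1,\boldsymbol i_2,\boldsymbol b$ is such a sequence. If $h_1<\dots<h_d$, every such sequence is $\boldsymbol i_1,\boldsymbol i_2,\boldsymbol a$ or $\boldsymbol i_1,\boldsymbol i_2,\boldsymbol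 b$; and there are strictly increasing $h$ for which $\boldsymbol a$ has strictly smaller energy than $\boldsymbol b$, and others for which it has strictly larger energy. For $h_1\le\dots\le h_d$ and any sequence $\boldsymbol j_1,\boldsymbol j_2,\boldsymbol j_3$ of three energetically lowest configurations, the operator $\Gamma=\sum_{k=1}^3 w_k|\boldsymbol j_k\rangle\langle\boldsymbol j_k|$, where $|\boldsymbol j\rangle$ is the Slater determinant of $\boldsymbol j$, lies in $\mathcal E^N(\boldsymbol w)$, and its one-particle reduced density matrix minimizes $\gamma\mapsto\mathrm{Tr}[h\gamma]$, $h=\sum_i h_i|i\rangle\langle i|$, over $\overline{\mathcal E}^1_N(\boldsymbol w)$. For $(\boldsymbol j_1,\boldsymbol j_2,\boldsymbol j_3)=(\boldsymbol i_1,\boldsymbol i_2,\boldsymbol a)$ this reduced density matrix is $\mathrm{diag}(\boldsymbol v^{(1)})$, and for $(\boldsymbol i_1,\boldsymbol i_2,\boldsymbol b)$ it is $\mathrm{diag}(\boldsymbol v^{(2)})$. (c) Halfspace representation. A vector $\boldsymbol\lambda\in\mathbb R^d$ lies in $\Sigma(\boldsymbol w)$ if and only if it satisfies the constraints of the case of two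 weights, that is, $\lambda_i\ge0$ for all $i$, $\sum_i\lambda_i=N$, $\lambda^\downarrow_1\le1$ and $\sum_{j=1}^N\lambda^\downarrow_j\le N-1+w_1$, together with the one new constraint $$2\sum_{j=1}^{N-1}\lambda^\downarrow_j+\lambda^\downarrow_N+\lambda^\downarrow_{N+1}\le 2N-2+w_1+w_2 .$$ The new constraint fails to follow from the preceding ones if and only if $w_2<w_1$ and $w_3>0$. -/

import Mathlib

noncomputable section

namespace WRDMFT

open scoped Matrix

/-- The `N`-fermion Hilbert space `⋀^N ℂ^d`, realised as the space of antisymmetric wave functions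
`Ψ(x₁, …, x_N)` inside `(ℂ^d)^{⊗N} = ℂ^(Fin N → Fin d)`. -/
def fermionSpace (N d : ℕ) : Submodule ℂ (EuclideanSpace ℂ (Fin N → Fin d)) where
  carrier := {Ψ | ∀ (σ : Equiv.Perm (Fin N)) (x : Fin N → Fin d),
    Ψ (x ∘ σ) = ((Equiv.Perm.sign σ : ℤ) : ℂ) * Ψ x}
  add_mem' := by
    intro a b ha hb σ x
    simp only [PiLp.add_apply, ha σ x, hb σ x, mul_add]
  zero_mem' := by
    intro σ x
    simp
  smul_mem' := by
    intro c a ha σ x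
    simp only [PiLp.smul_apply, smul_eq_mul, ha σ x]
    ring

/-- Linear operators on the `N`-fermion Hilbert space. -/
abbrev FermionOp (N d : ℕ) : Type :=
  fermionSpace N d →ₗ[ℂ] fermionSpace N d

/-- `T` is symmetric and its spectrum, listed in decreasing order with multiplicities, is
`w 0, w 1, …, w (D - 1)`, where `D` is the dimension of the space.
(Mathlib's `eigenvalues` is sorted decreasingly.) -/
def HasSpectrum {E : Type*} [NormedAddCommGroup E] [InnerProductSpace ℂ E]
    [FiniteDimensional ℂ E] (T : E →ₗ[ℂ] E) (w : ℕ → ℝ) : Prop :=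
  ∃ hT : T.IsSymmetric, ∀ i : Fin (Module.finrank ℂ E), hT.eigenvalues rfl i = w i

/-- The density operators (positive semidefinite, trace one) on `E` with decreasingly ordered
spectrum `w`. -/
def densityOperators (E : Type*) [NormedAddCommGroup E] [InnerProductSpace ℂ E]
    [FiniteDimensional ℂ E] (w : ℕ → ℝ) : Set (E →ₗ[ℂ] E) :=
  {Γ | Γ.IsPositive ∧ LinearMap.trace ℂ E Γ = 1 ∧ HasSpectrum Γ w}

/-- `𝓔^N(w)`: the `N`-fermion density operators with decreasingly ordered spectrum `w`. -/
def ensemble (N d : ℕ) (w : ℕ → ℝ) : Set (FermionOp N d) :=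
  densityOperators (fermionSpace N d) w

/-- The integral kernel `⟨x| Γ |y⟩` of an operator on the `N`-fermion space, the latter being
extended by zero to the orthogonal complement inside `(ℂ^d)^{⊗N}`. -/
def kernel {N d : ℕ} (Γ : FermionOp N d) (x y : Fin N → Fin d) : ℂ :=
  (Γ ((fermionSpace N d).orthogonalProjectionOnto (EuclideanSpace.single y 1)) :
    EuclideanSpace ℂ (Fin N → Fin d)) x

/-- The one-particle reduced density matrix `γ = N Tr_{N-1}[Γ]`, i.e.
`⟨a| γ |b⟩ = N ∑_{x₂, …, x_N} ⟨a, x₂, …, x_N| Γ |b, x₂, …, x_N⟩`. -/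
def oneRDM {N d : ℕ} [NeZero N] (Γ : FermionOp N d) : Matrix (Fin d) (Fin d) ℂ :=
  Matrix.of fun a b =>
    (N : ℂ) * ∑ x : Fin N → Fin d with x 0 = a, kernel Γ x (Function.update x 0 b)

/-- The convex hull of `𝓔¹_N(w) = N Tr_{N-1}[𝓔^N(w)]`: the relaxed `w`-ensemble
`N`-representable one-particle reduced density matrices. -/
def relaxedOneRDM (N d : ℕ) [NeZero N] (w : ℕ → ℝ) : Set (Matrix (Fin d) (Fin d) ℂ) :=
  convexHull ℝ (oneRDM '' ensemble N d w)

/-- `Σ(w)`: the set of all natural occupation number vectors, i.e. of all vectors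
`λ = (λ₁, …, λ_d)` of eigenvalues (with multiplicities, in any order) of matrices in
`relaxedOneRDM N d w`. -/
def spectralPolytope (N d : ℕ) [NeZero N] (w : ℕ → ℝ) : Set (Fin d → ℝ) :=
  {l | ∃ γ ∈ relaxedOneRDM N d w, ∃ hγ : γ.IsHermitian,
    ∃ σ : Equiv.Perm (Fin d), l = hγ.eigenvalues ∘ σ}

/-- The weight sequence `(w₁, w₂, w₃, 0, 0, …)`. -/
def weights (w₁ w₂ w₃ : ℝ) : ℕ → ℝ
  | 0 => w₁
  | 1 => w₂
  | 2 => w₃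
  | _ => 0

/-- `(1, …, 1, w₁, w₂, w₃, 0, …)` with `N - 1` leading ones. -/
def vertex₁ (N d : ℕ) (w₁ w₂ w₃ : ℝ) : Fin d → ℝ := fun i =>
  if (i : ℕ) + 1 < N then 1
  else if (i : ℕ) + 1 = N then w₁
  else if (i : ℕ) = N then w₂
  else if (i : ℕ) = N + 1 then w₃
  else 0

/-- `(1, …, 1, w₁ + w₂, w₁ + w₃, w₂ + w₃, 0, …)` with `N - 2` leading ones. -/
def vertex₂ (N d : ℕ) (w₁ w₂ w₃ : ℝ) : Fin d → ℝ := fun i =>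
  if (i : ℕ) + 2 < N then 1
  else if (i : ℕ) + 2 = N then w₁ + w₂
  else if (i : ℕ) + 1 = N then w₁ + w₃
  else if (i : ℕ) = N then w₂ + w₃
  else 0

/-- The vectors obtained from `v` by permuting its entries. -/
def permutations {d : ℕ} (v : Fin d → ℝ) : Set (Fin d → ℝ) :=
  Set.range fun σ : Equiv.Perm (Fin d) => v ∘ σ

/-- The decreasing rearrangement of `l`, counted from zero: `desc l k` is the `(k + 1)`-st largest
entry `λ↓_{k+1}` of `l` for `k < d` (and `0` for `k ≥ d`). -/
def desc {d : ℕ} (l : Fin d → ℝ) (k : ℕ) : ℝ :=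
  if h : k < d then l (Tuple.sort l (Fin.rev ⟨k, h⟩)) else 0

/-- The constraints already present for two nonvanishing weights: nonnegativity, normalisation to
the particle number, Pauli's exclusion principle `λ↓₁ ≤ 1`, and
`∑_{j ≤ N} λ↓_j ≤ N - 1 + w₁`. -/
def LevelTwoConstraints (N : ℕ) {d : ℕ} (w₁ : ℝ) (l : Fin d → ℝ) : Prop :=
  (∀ i, 0 ≤ l i) ∧ ∑ i, l i = N ∧ desc l 0 ≤ 1 ∧
    ∑ j ∈ Finset.range N, desc l j ≤ (N : ℝ) - 1 + w₁

/-- The constraint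
`2 ∑_{j ≤ N-1} λ↓_j + λ↓_N + λ↓_{N+1} ≤ 2N - 2 + w₁ + w₂`. -/
def LevelThreeConstraint (N : ℕ) {d : ℕ} (w₁ w₂ : ℝ) (l : Fin d → ℝ) : Prop :=
  2 * ∑ j ∈ Finset.range (N - 1), desc l j + desc l (N - 1) + desc l N
    ≤ 2 * (N : ℝ) - 2 + w₁ + w₂

/-- An `N`-fermion configuration `i₁ < i₂ < ⋯ < i_N`. -/
abbrev Config (N d : ℕ) : Type := Fin N ↪o Fin d

/-- The energy `∑_j h_{i_j}` of a configuration. -/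
def energy {N d : ℕ} (h : Fin d → ℝ) (i : Config N d) : ℝ := ∑ j, h (i j)

/-- `(i₁, i₂, i₃)` is a sequence of three energetically lowest configurations, in order of
increasing energy. -/
def IsLowestThree {N d : ℕ} (h : Fin d → ℝ) (i₁ i₂ i₃ : Config N d) : Prop :=
  i₁ ≠ i₂ ∧ i₁ ≠ i₃ ∧ i₂ ≠ i₃ ∧ energy h i₁ ≤ energy h i₂ ∧ energy h i₂ ≤ energy h i₃ ∧
    ∀ i : Config N d, i ≠ i₁ → i ≠ i₂ → i ≠ i₃ → energy h i₃ ≤ energy h i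

/-- The configuration `(1, …, N)`. -/
def configGround {N d : ℕ} (hd : N + 2 ≤ d) : Config N d :=
  OrderEmbedding.ofStrictMono (fun j => (⟨j, by omega⟩ : Fin d)) (fun _ _ hab => hab)

/-- The configuration `(1, …, N - 1, N + 1)`. -/
def configFirst {N d : ℕ} (hd : N + 2 ≤ d) : Config N d :=
  OrderEmbedding.ofStrictMono
    (fun j => (⟨if N ≤ (j : ℕ) + 1 then j + 1 else j, by split_ifs <;> omega⟩ : Fin d))
    (fun a b hab => by
      have h : (a : ℕ) < b := hab
      simp only [Fin.mk_lt_mk]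
      split_ifs <;> omega)

/-- The configuration `(1, …, N - 1, N + 2)`. -/
def configA {N d : ℕ} (hd : N + 2 ≤ d) : Config N d :=
  OrderEmbedding.ofStrictMono
    (fun j => (⟨if N ≤ (j : ℕ) + 1 then j + 2 else j, by split_ifs <;> omega⟩ : Fin d))
    (fun a b hab => by
      have h : (a : ℕ) < b := hab
      simp only [Fin.mk_lt_mk]
      split_ifs <;> omega)

/-- The configuration `(1, …, N - 2, N, N + 1)`. -/
def configB {N d : ℕ} (hd : N + 2 ≤ d) : Config N d :=
  OrderEmbedding.ofStrictMono
    (fun j => (⟨if N ≤ (j : ℕ) + 2 then j + 1 else j, by split_ifs <;> omega⟩ : Fin d))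
    (fun a b hab => by
      have h : (a : ℕ) < b := hab
      simp only [Fin.mk_lt_mk]
      split_ifs <;> omega)

/-- The configuration state (normalised Slater determinant) `|i₁, …, i_N⟩`. -/
def slater {N d : ℕ} (i : Config N d) : fermionSpace N d :=
  ⟨WithLp.toLp 2 fun x : Fin N → Fin d =>
      ((Real.sqrt (Nat.factorial N) : ℝ) : ℂ)⁻¹ *
        Matrix.det (Matrix.of fun a b : Fin N => if x a = i b then (1 : ℂ) else 0),
    by
      intro σ x
      have h := Matrix.det_permute σ
        (Matrix.of fun a b : Fin N => if x a = i b then (1 : ℂ) else 0)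
      have h' : (Matrix.of fun a b : Fin N => if (x ∘ σ) a = i b then (1 : ℂ) else 0)
          = (Matrix.of fun a b : Fin N => if x a = i b then (1 : ℂ) else 0).submatrix σ id := by
        ext a b
        simp
      simp only [h', h]
      ring⟩

/-- The density operator
`w₁ |i₁⟩⟨i₁| + w₂ |i₂⟩⟨i₂| + w₃ |i₃⟩⟨i₃|` for configurations `i₁, i₂, i₃`. -/
def configMixture {N d : ℕ} (w₁ w₂ w₃ : ℝ) (i₁ i₂ i₃ : Config N d) : FermionOp N d :=
  (w₁ : ℂ) • (InnerProductSpace.rankOne ℂ (slater i₁) (slater i₁)).toLinearMap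
    + (w₂ : ℂ) • (InnerProductSpace.rankOne ℂ (slater i₂) (slater i₂)).toLinearMap
    + (w₃ : ℂ) • (InnerProductSpace.rankOne ℂ (slater i₃) (slater i₃)).toLinearMap

/-- The one-particle energy `Tr[h γ]` for `h = ∑_i h_i |i⟩⟨i|`. -/
def oneBodyEnergy {d : ℕ} (h : Fin d → ℝ) (γ : Matrix (Fin d) (Fin d) ℂ) : ℝ :=
  (Matrix.trace (Matrix.diagonal (fun i => (h i : ℂ)) * γ)).re

end WRDMFT

end

noncomputable section

namespace WRDMFT

open scoped Matrix

/-! ### Rearrangements and majorization -/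

/-! The argument runs through support functions. By Hahn–Banach and sorting of coefficients, `l`
lies in the hull of the permutations of `v₁` and `v₂` once `∑ c_k l_{τ k} ≤ max (c·v₁) (c·v₂)` for
every decreasing `c` and every permutation `τ` (`mem_convexHull_permutations`).

For occupation vectors this inequality is the ensemble variational principle for the one-body
Hamiltonian `h = -c`. If `Γ` has orthonormal eigenvectors `φ_k` with weights `w_k`, the numbers
`|⟨i|φ_k⟩|²`, with `i` over Slater determinants, have row sums one and column sums at most one. The
weighted energy is therefore at least `w₁E₁ + w₂E₂ + w₃E₃`, with `E₁, E₂, E₃` the lowest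
configuration energies (`weighted_sum_energy_ge`). The bound is linear in `γ`, so it survives the
convex hull. A unitary change of orbitals conjugates `γ` (`pureRDM_rotate`), so it may be tested on
the eigenvalues in any order (`exists_conj_diag_eq`). In the componentwise order, every
configuration except the two lowest dominates `configA` or `configB` (`configA_or_configB_le`); the
resulting occupation numbers are the two vertices. Conversely, Slater mixtures with relabelled
orbitals realise each permuted vertex as a diagonal reduced density matrix.

For the halfspaces, the partial sums of the two vertices differ only at length `N - 1`, where
`vertex₂` is lower by `w₃`, and at length `N + 1`, where `vertex₁` is lower by `w₃`. Majorization by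
some mixture `θ v₁ + (1 - θ) v₂` trades one deficit against the other, which leaves one inequality
on the sum of these two partial sums: the new constraint (`mem_convexHull_of_constraints`). The same
two partial sums show that neither orbit can be dropped when `w₃ > 0`; Krein–Milman and permutation
symmetry then give the extreme points. -/

theorem eq_of_antitone_of_map_eq {n : ℕ} {f g : Fin n → ℝ} (hf : Antitone f) (hg : Antitone g)
    (h : Finset.univ.val.map f = Finset.univ.val.map g) : f = g := by
  rw [Fin.univ_val_map, Fin.univ_val_map, Multiset.coe_eq_coe] at h
  rw [← List.ofFn_inj]
  exact h.eq_of_sortedGE hf.sortedGE_ofFn hg.sortedGE_ofFn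

/-- The permutation that sorts `l` decreasingly. -/
def descPerm {d : ℕ} (l : Fin d → ℝ) : Equiv.Perm (Fin d) := Fin.revPerm.trans (Tuple.sort l)

theorem desc_coe {d : ℕ} (l : Fin d → ℝ) (k : Fin d) : desc l k = l (descPerm l k) := by
  simp [desc, descPerm]

theorem antitone_comp_descPerm {d : ℕ} (l : Fin d → ℝ) : Antitone (l ∘ descPerm l) := by
  intro a b hab
  exact Tuple.monotone_sort l (Fin.rev_le_rev.mpr hab)

theorem antitone_desc {d : ℕ} (l : Fin d → ℝ) : Antitone fun k : Fin d => desc l k := by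
  intro a b hab
  simp only [desc_coe]
  exact antitone_comp_descPerm l hab

theorem map_comp_perm {n : ℕ} (f : Fin n → ℝ) (σ : Equiv.Perm (Fin n)) :
    Finset.univ.val.map (f ∘ σ) = Finset.univ.val.map f := by
  rw [← Multiset.map_map]
  congr 1
  simp

theorem exists_perm_eq_comp_of_map_eq {n : ℕ} {f g : Fin n → ℝ}
    (h : Finset.univ.val.map f = Finset.univ.val.map g) :
    ∃ σ : Equiv.Perm (Fin n), f = g ∘ σ := by
  have := eq_of_antitone_of_map_eq (antitone_comp_descPerm f) (antitone_comp_descPerm g)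
    (by rw [map_comp_perm, map_comp_perm, h])
  refine ⟨(descPerm f).symm.trans (descPerm g), ?_⟩
  ext i
  simpa using congrFun this ((descPerm f).symm i)

theorem desc_comp_perm {d : ℕ} {v : Fin d → ℝ} (hv : Antitone v) (σ : Equiv.Perm (Fin d))
    (k : Fin d) : desc (v ∘ σ) k = v k := by
  rw [desc_coe]
  exact congrFun (eq_of_antitone_of_map_eq (antitone_comp_descPerm (v ∘ σ)) hv
    (by rw [map_comp_perm, map_comp_perm])) k

theorem sum_desc {d : ℕ} (l : Fin d → ℝ) : ∑ k : Fin d, desc l k = ∑ i, l i := by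
  simp_rw [desc_coe]
  exact Equiv.sum_comp (descPerm l) l

theorem sum_mul_comp_perm_le_sum_mul_desc {d : ℕ} {c : Fin d → ℝ} (hc : Antitone c)
    (l : Fin d → ℝ) (τ : Equiv.Perm (Fin d)) :
    ∑ k, c k * l (τ k) ≤ ∑ k, c k * desc l k := by
  have h : Monovary c fun k => desc l k := hc.monovary (antitone_desc l)
  have := h.sum_mul_comp_perm_le_sum_mul (σ := τ.trans (descPerm l).symm)
  simpa [desc_coe] using this

/-- Abel summation, one step at a time: since the partial sums are nonpositive, lowering their
coefficient from `c n` to `c (n + 1)` only increases the bound. No sign of `c` is needed because the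
full sum stays on the right. -/
theorem sum_range_mul_le (n : ℕ) (c u : ℕ → ℝ) (hc : ∀ k, k < n → c (k + 1) ≤ c k)
    (hu : ∀ k, k ≤ n → ∑ j ∈ Finset.range k, u j ≤ 0) :
    ∑ k ∈ Finset.range (n + 1), c k * u k ≤ c n * ∑ k ∈ Finset.range (n + 1), u k := by
  induction n with
  | zero => simp
  | succ n ih =>
    have h1 := ih (fun k hk => hc k (by omega)) (fun k hk => hu k (by omega))
    rw [Finset.sum_range_succ, Finset.sum_range_succ _ (n + 1)]
    have h2 := hu (n + 1) le_rfl
    have h3 := hc n (by omega)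
    nlinarith

/-- If `l` is majorized by `v`, then `∑ c_k l_k ≤ ∑ c_k v_k` for decreasing `c`. -/
theorem sum_mul_le_sum_mul_of_majorized {d : ℕ} {c : Fin d → ℝ} (hc : Antitone c) (l v : ℕ → ℝ)
    (h : ∀ k, k ≤ d → ∑ j ∈ Finset.range k, l j ≤ ∑ j ∈ Finset.range k, v j)
    (htot : ∑ j ∈ Finset.range d, l j = ∑ j ∈ Finset.range d, v j) :
    ∑ k, c k * l k ≤ ∑ k, c k * v k := by
  cases d with
  | zero => simp
  | succ n =>
    let c' : ℕ → ℝ := fun k => if h : k < n + 1 then c ⟨k, h⟩ else 0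
    have hc' : ∀ k : Fin (n + 1), c k = c' k := fun k => by simp [c', -Order.lt_add_one_iff]
    have h1 := sum_range_mul_le n c' (fun k => l k - v k)
      (fun k hk => by
        have h2 : k + 1 < n + 1 := by omega
        have h3 : k < n + 1 := by omega
        simp only [c', h2, h3, dif_pos]
        exact hc (by simp [Fin.le_def]))
      (fun k hk => by
        rw [Finset.sum_sub_distrib]
        linarith [h k (by omega)])
    rw [Finset.sum_sub_distrib, htot, sub_self, mul_zero] at h1
    simp_rw [hc']
    rw [Fin.sum_univ_eq_sum_range (fun k => c' k * l k),
      Fin.sum_univ_eq_sum_range (fun k => c' k * v k)]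
    simp_rw [mul_sub, Finset.sum_sub_distrib] at h1
    linarith

/-! ### Support functions of hulls of permutation orbits. -/

theorem finite_permutations {d : ℕ} (v : Fin d → ℝ) : (permutations v).Finite :=
  Set.finite_range _

/-- A vector below the support function of the hull of all permutations of `v₁` and `v₂` lies in
this hull. -/
theorem mem_convexHull_permutations {d : ℕ} {v₁ v₂ l : Fin d → ℝ}
    (H : ∀ c : Fin d → ℝ, Antitone c → ∀ τ : Equiv.Perm (Fin d),
      ∑ k, c k * l (τ k) ≤ max (∑ k, c k * v₁ k) (∑ k, c k * v₂ k)) :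
    l ∈ convexHull ℝ (permutations v₁ ∪ permutations v₂) := by
  by_contra hl
  have hfin : (permutations v₁ ∪ permutations v₂).Finite :=
    (finite_permutations _).union (finite_permutations _)
  obtain ⟨f, u, hf, hu⟩ := geometric_hahn_banach_closed_point (convex_convexHull ℝ _)
    (hfin.isCompact_convexHull ℝ).isClosed hl
  set h : Fin d → ℝ := fun i => f (Pi.single i 1) with hh
  have hfx : ∀ x : Fin d → ℝ, f x = ∑ i, h i * x i := by
    intro x
    conv_lhs => rw [pi_eq_sum_univ' x]
    simp [hh, mul_comm]
  have hv : ∀ v : Fin d → ℝ, v ∈ permutations v₁ ∪ permutations v₂ → f v < u := fun v hv =>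
    hf v (subset_convexHull ℝ _ hv)
  -- Sorting the coefficients of the separating functional makes them decreasing; its values at
  -- suitably permuted vertices become the two pairings in `H`, all below `u`, whereas `f l` exceeds
  -- `u`.
  have key : ∀ v : Fin d → ℝ, ∑ k, (h ∘ descPerm h) k * v k = f (v ∘ (descPerm h).symm) := by
    intro v
    rw [hfx, ← Equiv.sum_comp (descPerm h) fun i => h i * (v ∘ (descPerm h).symm) i]
    simp
  have h1 := H (h ∘ descPerm h) (antitone_comp_descPerm h) (descPerm h)
  have h2 := key (l ∘ descPerm h)
  simp only [Function.comp_apply] at h2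
  have h3 : (l ∘ descPerm h) ∘ (descPerm h).symm = l := by ext; simp
  rw [h3] at h2
  simp only [Function.comp_apply] at h1
  rw [h2] at h1
  have h4 := hv _ (Or.inl ⟨(descPerm h).symm, rfl⟩)
  have h5 := hv _ (Or.inr ⟨(descPerm h).symm, rfl⟩)
  have h6 := key v₁
  have h7 := key v₂
  simp only [Function.comp_apply] at h6 h7
  rw [h6, h7] at h1
  rcases le_max_iff.mp h1 with h | h <;> linarith

theorem convexHull_permutations_linear_le {d : ℕ} {v₁ v₂ l : Fin d → ℝ}
    (hl : l ∈ convexHull ℝ (permutations v₁ ∪ permutations v₂)) {a : Fin d → ℝ} {B : ℝ}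
    (h₁ : ∀ σ : Equiv.Perm (Fin d), ∑ k, a k * v₁ (σ k) ≤ B)
    (h₂ : ∀ σ : Equiv.Perm (Fin d), ∑ k, a k * v₂ (σ k) ≤ B) : ∑ k, a k * l k ≤ B := by
  have hconv : Convex ℝ {x : Fin d → ℝ | ∑ k, a k * x k ≤ B} := by
    refine convex_halfSpace_le ⟨fun x y => ?_, fun c x => ?_⟩ B
    · simp [mul_add, Finset.sum_add_distrib]
    · simp only [Pi.smul_apply, smul_eq_mul, Finset.mul_sum]
      exact Finset.sum_congr rfl fun _ _ => by ring
  refine convexHull_min ?_ hconv hl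
  rintro _ (⟨σ, rfl⟩ | ⟨σ, rfl⟩)
  · exact h₁ σ
  · exact h₂ σ

theorem sum_mul_comp_perm_le_of_antitone {d : ℕ} {c v : Fin d → ℝ} (hc : Antitone c)
    (hv : Antitone v) (σ : Equiv.Perm (Fin d)) : ∑ k, c k * v (σ k) ≤ ∑ k, c k * v k :=
  (hc.monovary hv).sum_mul_comp_perm_le_sum_mul

/-- The left side is not linear in `l`, but for the given `l` it is the value at `l` of the linear
functional with coefficients `c ∘ (descPerm l).symm`. On permuted vertices that functional is
bounded by rearrangement. -/
theorem sum_mul_desc_le_of_mem_convexHull {d : ℕ} {v₁ v₂ l : Fin d → ℝ} (hv₁ : Antitone v₁)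
    (hv₂ : Antitone v₂) (hl : l ∈ convexHull ℝ (permutations v₁ ∪ permutations v₂))
    {c : Fin d → ℝ} (hc : Antitone c) {B : ℝ} (h₁ : ∑ k, c k * v₁ k ≤ B)
    (h₂ : ∑ k, c k * v₂ k ≤ B) : ∑ k, c k * desc l k ≤ B := by
  have h := convexHull_permutations_linear_le (a := c ∘ (descPerm l).symm) (B := B) hl ?_ ?_
  · rw [← Equiv.sum_comp (descPerm l)] at h
    simpa [desc_coe] using h
  all_goals
    intro σ
    rw [← Equiv.sum_comp (descPerm l)]
    simp only [Function.comp_apply, Equiv.symm_apply_apply]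
  · exact (sum_mul_comp_perm_le_of_antitone hc hv₁ ((descPerm l).trans σ)).trans h₁
  · exact (sum_mul_comp_perm_le_of_antitone hc hv₂ ((descPerm l).trans σ)).trans h₂

theorem sum_indicator_mul {d m : ℕ} (hm : m ≤ d) (g : ℕ → ℝ) :
    ∑ k : Fin d, (if (k : ℕ) < m then (1 : ℝ) else 0) * g k = ∑ j ∈ Finset.range m, g j := by
  rw [Fin.sum_univ_eq_sum_range (fun k => (if k < m then (1 : ℝ) else 0) * g k)]
  simp_rw [ite_mul, one_mul, zero_mul]
  rw [← Finset.sum_filter]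
  congr 1
  ext k
  simp
  omega

theorem antitone_indicator (d m : ℕ) :
    Antitone fun k : Fin d => if (k : ℕ) < m then (1 : ℝ) else 0 := by
  intro a b hab
  have : (a : ℕ) ≤ b := hab
  simp only
  split_ifs <;> first | omega | norm_num

/-! ### The two vertices and the constraints -/

/-- The entries of `vertex₁` as a sequence. -/
def vertexSeq₁ (N : ℕ) (w₁ w₂ w₃ : ℝ) (i : ℕ) : ℝ :=
  if i + 1 < N then 1 else if i + 1 = N then w₁ else if i = N then w₂
  else if i = N + 1 then w₃ else 0

/-- The entries of `vertex₂` as a sequence. -/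
def vertexSeq₂ (N : ℕ) (w₁ w₂ w₃ : ℝ) (i : ℕ) : ℝ :=
  if i + 2 < N then 1 else if i + 2 = N then w₁ + w₂ else if i + 1 = N then w₁ + w₃
  else if i = N then w₂ + w₃ else 0

theorem sum_vertexSeq₁ (m : ℕ) (w₁ w₂ w₃ : ℝ) (k : ℕ) :
    ∑ j ∈ Finset.range k, vertexSeq₁ (m + 2) w₁ w₂ w₃ j =
      if k ≤ m + 1 then (k : ℝ) else if k = m + 2 then m + 1 + w₁
      else if k = m + 3 then m + 1 + w₁ + w₂ else m + 1 + w₁ + w₂ + w₃ := by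
  induction k with
  | zero => simp
  | succ k ih =>
    rw [Finset.sum_range_succ, ih, vertexSeq₁]
    rcases lt_or_ge k (m + 1) with h | h
    · simp [show k ≤ m + 1 by omega, show k + 1 ≤ m + 1 by omega, show k + 1 < m + 2 by omega]
    · obtain ⟨e, rfl⟩ := Nat.exists_eq_add_of_le h
      rcases e with _ | _ | _ | e
      · simp
      · simp
      · simp; split_ifs <;> first | omega | simp
      · simp; split_ifs <;> first | omega | simp

/-- For weights of total one, comparison with `sum_vertexSeq₁` shows equal partial sums except at `m
+ 1` and `m + 3`, where `vertexSeq₂` is respectively lower and higher by `w₃`. -/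
theorem sum_vertexSeq₂ (m : ℕ) (w₁ w₂ w₃ : ℝ) (k : ℕ) :
    ∑ j ∈ Finset.range k, vertexSeq₂ (m + 2) w₁ w₂ w₃ j =
      if k ≤ m then (k : ℝ) else if k = m + 1 then m + w₁ + w₂
      else if k = m + 2 then m + w₁ + w₂ + (w₁ + w₃)
      else m + w₁ + w₂ + (w₁ + w₃) + (w₂ + w₃) := by
  induction k with
  | zero => simp
  | succ k ih =>
    rw [Finset.sum_range_succ, ih, vertexSeq₂]
    rcases lt_or_ge k m with h | h
    · simp [show k ≤ m by omega, show k + 1 ≤ m by omega, show k < m by omega]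
    · obtain ⟨e, rfl⟩ := Nat.exists_eq_add_of_le h
      rcases e with _ | _ | _ | e
      · simp [add_assoc]
      · simp
      · simp
      · simp

section
variable {m d : ℕ} {w₁ w₂ w₃ : ℝ}

theorem antitone_vertex₁ (h₁₂ : w₂ ≤ w₁) (h₂₃ : w₃ ≤ w₂) (h₃ : 0 ≤ w₃)
    (hsum : w₁ + w₂ + w₃ = 1) : Antitone (vertex₁ (m + 2) d w₁ w₂ w₃) := by
  intro a b hab
  have : (a : ℕ) ≤ b := hab
  simp only [vertex₁]
  split_ifs <;> first | omega | linarith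

theorem antitone_vertex₂ (h₁₂ : w₂ ≤ w₁) (h₂₃ : w₃ ≤ w₂) (h₃ : 0 ≤ w₃)
    (hsum : w₁ + w₂ + w₃ = 1) : Antitone (vertex₂ (m + 2) d w₁ w₂ w₃) := by
  intro a b hab
  have : (a : ℕ) ≤ b := hab
  simp only [vertex₂]
  split_ifs <;> first | omega | linarith

theorem sum_range_desc_le {l : Fin d → ℝ} (h0 : desc l 0 ≤ 1) {k : ℕ} (hk : k ≤ d) :
    ∑ j ∈ Finset.range k, desc l j ≤ k := by
  have h : ∀ j ∈ Finset.range k, desc l j ≤ 1 := by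
    intro j hj
    have hj' := Finset.mem_range.mp hj
    have := antitone_desc l (show (⟨0, by omega⟩ : Fin d) ≤ ⟨j, by omega⟩ by simp [Fin.le_def])
    exact le_trans this h0
  simpa using Finset.sum_le_card_nsmul _ _ _ h

theorem sum_range_desc_eq (l : Fin d → ℝ) :
    ∑ j ∈ Finset.range d, desc l j = ∑ i, l i := by
  rw [← sum_desc, Fin.sum_univ_eq_sum_range (fun k => desc l k)]

theorem desc_nonneg {l : Fin d → ℝ} (h : ∀ i, 0 ≤ l i) (k : ℕ) : 0 ≤ desc l k := by
  unfold desc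
  split_ifs
  · exact h _
  · exact le_rfl

/-- Exhibits the new constraint as a bound on the partial sums of lengths `N - 1` and `N + 1`
together, that is, on a functional with decreasing coefficients `2, …, 2, 1, 1, 0, …`. -/
theorem levelThree_sum (l : Fin d → ℝ) : 2 * ∑ j ∈ Finset.range (m + 1), desc l j
      + desc l (m + 1) + desc l (m + 2)
    = ∑ j ∈ Finset.range (m + 1), desc l j + ∑ j ∈ Finset.range (m + 3), desc l j := by
  rw [Finset.sum_range_succ _ (m + 2), Finset.sum_range_succ _ (m + 1)]
  ring

/-- The sorted `l` is majorized by a mixture of the two vertices, and a linear functional on a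
mixture is at most the larger of its values at the two ends. -/
theorem mem_convexHull_of_constraints (hd : m + 2 + 2 ≤ d) (hsum : w₁ + w₂ + w₃ = 1)
    (h₃ : 0 ≤ w₃) {l : Fin d → ℝ} (hl₂ : LevelTwoConstraints (m + 2) w₁ l)
    (hl₃ : LevelThreeConstraint (m + 2) w₁ w₂ l) :
    l ∈ convexHull ℝ (permutations (vertex₁ (m + 2) d w₁ w₂ w₃) ∪
      permutations (vertex₂ (m + 2) d w₁ w₂ w₃)) := by
  obtain ⟨hpos, htot, hone, hN⟩ := hl₂
  have hpair := hl₃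
  unfold LevelThreeConstraint at hpair
  rw [show m + 2 - 1 = m + 1 by omega, levelThree_sum] at hpair
  push_cast at hN hpair htot
  have hA := sum_range_desc_le hone (show m + 1 ≤ d by omega)
  have hB : ∀ k, k ≤ d → ∑ j ∈ Finset.range k, desc l j ≤ m + 2 := by
    intro k hk
    rw [← htot, ← sum_range_desc_eq]
    exact Finset.sum_le_sum_of_subset_of_nonneg (by simpa using hk)
      fun j _ _ => desc_nonneg hpos j
  have hB3 := hB (m + 3) (by omega)
  push_cast at hA
  set A := ∑ j ∈ Finset.range (m + 1), desc l j with hAdef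
  set B := ∑ j ∈ Finset.range (m + 3), desc l j with hBdef
  -- For `w₃ > 0`, `θ` is the largest value in `[0, 1]` permitted by the bound on `B`. If it is `1`,
  -- the bound on `A` is Pauli's; otherwise the bound on `B` is saturated and the new constraint
  -- gives the one on `A`.
  obtain ⟨θ, hθ0, hθ1, hθA, hθB⟩ : ∃ θ : ℝ, 0 ≤ θ ∧ θ ≤ 1 ∧ A ≤ m + 1 - (1 - θ) * w₃ ∧
      B ≤ m + 2 - θ * w₃ := by
    rcases h₃.eq_or_lt with h0 | h0
    · exact ⟨0, le_rfl, zero_le_one, by rw [← h0]; linarith, by rw [← h0]; linarith⟩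
    · refine ⟨min 1 ((m + 2 - B) / w₃), le_min zero_le_one (div_nonneg (by linarith) h0.le),
        min_le_left _ _, ?_, ?_⟩
      · rcases le_total 1 ((m + 2 - B) / w₃) with h | h
        · rw [min_eq_left h]; linarith
        · rw [min_eq_right h, sub_mul, div_mul_cancel₀ _ h0.ne']; linarith
      · have := mul_le_mul_of_nonneg_right (min_le_right 1 ((m + 2 - B) / w₃)) h0.le
        rw [div_mul_cancel₀ _ h0.ne'] at this
        linarith
  refine mem_convexHull_permutations fun c hc τ => ?_
  have h1 := sum_mul_comp_perm_le_sum_mul_desc hc l τ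
  have h2 := sum_mul_le_sum_mul_of_majorized hc (desc l)
    (fun k => θ * vertexSeq₁ (m + 2) w₁ w₂ w₃ k + (1 - θ) * vertexSeq₂ (m + 2) w₁ w₂ w₃ k) ?_ ?_
  · have h3 : ∑ k : Fin d, c k * (θ * vertexSeq₁ (m + 2) w₁ w₂ w₃ k
          + (1 - θ) * vertexSeq₂ (m + 2) w₁ w₂ w₃ k)
        = θ * ∑ k, c k * vertex₁ (m + 2) d w₁ w₂ w₃ k
          + (1 - θ) * ∑ k, c k * vertex₂ (m + 2) d w₁ w₂ w₃ k := by
      rw [Finset.mul_sum, Finset.mul_sum, ← Finset.sum_add_distrib]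
      refine Finset.sum_congr rfl fun k _ => ?_
      simp only [vertex₁, vertex₂, vertexSeq₁, vertexSeq₂]
      ring
    rw [h3] at h2
    refine h1.trans (h2.trans ?_)
    have h4 := mul_le_mul_of_nonneg_left (le_max_left (∑ k, c k * vertex₁ (m + 2) d w₁ w₂ w₃ k)
      (∑ k, c k * vertex₂ (m + 2) d w₁ w₂ w₃ k)) hθ0
    have h5 := mul_le_mul_of_nonneg_left (le_max_right (∑ k, c k * vertex₁ (m + 2) d w₁ w₂ w₃ k)
      (∑ k, c k * vertex₂ (m + 2) d w₁ w₂ w₃ k)) (sub_nonneg.mpr hθ1)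
    linarith
  · intro k hk
    rw [Finset.sum_add_distrib, ← Finset.mul_sum, ← Finset.mul_sum, sum_vertexSeq₁,
      sum_vertexSeq₂]
    rcases lt_or_ge k (m + 1) with hk1 | hk1
    · simp only [show k ≤ m + 1 by omega, show k ≤ m by omega, if_true]
      linarith [sum_range_desc_le hone hk]
    · obtain ⟨e, rfl⟩ := Nat.exists_eq_add_of_le hk1
      rcases e with _ | _ | _ | e
      · simp only [add_zero, le_refl, if_true, show ¬ m + 1 ≤ m by omega, if_false, ← hAdef]
        push_cast
        have : w₁ + w₂ = 1 - w₃ := by linarith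
        nlinarith
      · simp only [zero_add, add_assoc, Nat.reduceAdd, show ¬ m + 2 ≤ m + 1 by omega, if_true,
          show ¬ m + 2 ≤ m by omega, show ¬ m + 2 = m + 1 by omega, if_false]
        have : w₂ = 1 - w₃ - w₁ := by linarith
        subst this
        linarith
      · simp only [zero_add, add_assoc, Nat.reduceAdd, show ¬ m + 3 ≤ m + 1 by omega, if_true,
          show ¬ m + 3 ≤ m by omega, show ¬ m + 3 = m + 1 by omega, if_false,
          show ¬ m + 3 = m + 2 by omega, ← hBdef]
        have : w₂ = 1 - w₃ - w₁ := by linarith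
        subst this
        linarith
      · have hb := hB _ hk
        rw [if_neg (by omega), if_neg (by omega), if_neg (by omega), if_neg (by omega),
          if_neg (by omega), if_neg (by omega)]
        have : w₂ = 1 - w₃ - w₁ := by linarith
        subst this
        linarith
  · rw [Finset.sum_add_distrib, ← Finset.mul_sum, ← Finset.mul_sum, sum_vertexSeq₁,
      sum_vertexSeq₂, sum_range_desc_eq, htot]
    rw [if_neg (by omega), if_neg (by omega), if_neg (by omega), if_neg (by omega),
          if_neg (by omega), if_neg (by omega)]
    have : w₂ = 1 - w₃ - w₁ := by linarith
    subst this
    ring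

/-- Two partial sums are bounded jointly because the new constraint has this form; `b = 0` recovers
a single partial sum. -/
theorem sum_range_desc_le_of_mem_convexHull {v₁ v₂ : ℕ → ℝ}
    (hv₁ : Antitone fun k : Fin d => v₁ k) (hv₂ : Antitone fun k : Fin d => v₂ k) {l : Fin d → ℝ}
    (hl : l ∈ convexHull ℝ (permutations (fun k : Fin d => v₁ k) ∪
      permutations (fun k : Fin d => v₂ k))) {a b : ℕ} (ha : a ≤ d) (hb : b ≤ d) {B : ℝ}
    (h₁ : ∑ j ∈ Finset.range a, v₁ j + ∑ j ∈ Finset.range b, v₁ j ≤ B)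
    (h₂ : ∑ j ∈ Finset.range a, v₂ j + ∑ j ∈ Finset.range b, v₂ j ≤ B) :
    ∑ j ∈ Finset.range a, desc l j + ∑ j ∈ Finset.range b, desc l j ≤ B := by
  have key : ∀ g : ℕ → ℝ, ∑ k : Fin d, ((if (k : ℕ) < a then (1 : ℝ) else 0)
      + (if (k : ℕ) < b then (1 : ℝ) else 0)) * g k
      = ∑ j ∈ Finset.range a, g j + ∑ j ∈ Finset.range b, g j := by
    intro g
    simp_rw [add_mul, Finset.sum_add_distrib]
    rw [sum_indicator_mul ha, sum_indicator_mul hb]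
  rw [← key] at h₁ h₂ ⊢
  exact sum_mul_desc_le_of_mem_convexHull hv₁ hv₂ hl
    ((antitone_indicator d a).add (antitone_indicator d b)) h₁ h₂

theorem constraints_of_mem_convexHull (hd : m + 2 + 2 ≤ d) (h₁₂ : w₂ ≤ w₁) (h₂₃ : w₃ ≤ w₂)
    (h₃ : 0 ≤ w₃) (hsum : w₁ + w₂ + w₃ = 1) {l : Fin d → ℝ}
    (hl : l ∈ convexHull ℝ (permutations (vertex₁ (m + 2) d w₁ w₂ w₃) ∪
      permutations (vertex₂ (m + 2) d w₁ w₂ w₃))) :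
    LevelTwoConstraints (m + 2) w₁ l ∧ LevelThreeConstraint (m + 2) w₁ w₂ l := by
  have hw₂ : w₂ = 1 - w₃ - w₁ := by linarith
  have hv₁ : Antitone (fun k : Fin d => vertexSeq₁ (m + 2) w₁ w₂ w₃ k) :=
    antitone_vertex₁ h₁₂ h₂₃ h₃ hsum
  have hv₂ : Antitone (fun k : Fin d => vertexSeq₂ (m + 2) w₁ w₂ w₃ k) :=
    antitone_vertex₂ h₁₂ h₂₃ h₃ hsum
  have hl' : l ∈ convexHull ℝ (permutations (fun k : Fin d => vertexSeq₁ (m + 2) w₁ w₂ w₃ k) ∪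
      permutations (fun k : Fin d => vertexSeq₂ (m + 2) w₁ w₂ w₃ k)) := hl
  have htot₁ : ∑ k : Fin d, vertex₁ (m + 2) d w₁ w₂ w₃ k = m + 2 := by
    have := Fin.sum_univ_eq_sum_range (vertexSeq₁ (m + 2) w₁ w₂ w₃) d
    rw [sum_vertexSeq₁, if_neg (by omega), if_neg (by omega), if_neg (by omega)] at this
    exact this.trans (by linarith)
  have htot₂ : ∑ k : Fin d, vertex₂ (m + 2) d w₁ w₂ w₃ k = m + 2 := by
    have := Fin.sum_univ_eq_sum_range (vertexSeq₂ (m + 2) w₁ w₂ w₃) d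
    rw [sum_vertexSeq₂, if_neg (by omega), if_neg (by omega), if_neg (by omega)] at this
    exact this.trans (by linarith)
  refine ⟨⟨fun i => ?_, ?_, ?_, ?_⟩, ?_⟩
  · have := convexHull_permutations_linear_le hl (a := Pi.single i (-1)) (B := 0) ?_ ?_
    · simpa [Pi.single_apply] using this
    · intro σ
      simp only [Pi.single_apply, ite_mul, zero_mul, Finset.sum_ite_eq', Finset.mem_univ, if_true,
        vertex₁]
      split_ifs <;> linarith
    · intro σ
      simp only [Pi.single_apply, ite_mul, zero_mul, Finset.sum_ite_eq', Finset.mem_univ, if_true,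
        vertex₂]
      split_ifs <;> linarith
  · push_cast
    refine le_antisymm ?_ ?_
    · have := convexHull_permutations_linear_le hl (a := fun _ => 1) (B := m + 2) ?_ ?_
      · simpa using this
      · intro σ
        simp only [one_mul]
        rw [Equiv.sum_comp σ (vertex₁ (m + 2) d w₁ w₂ w₃), htot₁]
      · intro σ
        simp only [one_mul]
        rw [Equiv.sum_comp σ (vertex₂ (m + 2) d w₁ w₂ w₃), htot₂]
    · have := convexHull_permutations_linear_le hl (a := fun _ => -1) (B := -(m + 2)) ?_ ?_
      · simp only [neg_mul, one_mul, Finset.sum_neg_distrib] at this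
        linarith
      · intro σ
        simp only [neg_mul, one_mul, Finset.sum_neg_distrib]
        rw [Equiv.sum_comp σ (vertex₁ (m + 2) d w₁ w₂ w₃), htot₁]
      · intro σ
        simp only [neg_mul, one_mul, Finset.sum_neg_distrib]
        rw [Equiv.sum_comp σ (vertex₂ (m + 2) d w₁ w₂ w₃), htot₂]
  · have := sum_range_desc_le_of_mem_convexHull hv₁ hv₂ hl' (a := 1) (b := 0) (B := 1) (by omega)
      (by omega) ?_ ?_
    · simpa using this
    · simp only [sum_vertexSeq₁]
      simp
    · simp only [sum_vertexSeq₂]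
      simp only [Nat.zero_le, if_true]
      -- For `N = 2` the second vertex has no leading ones, and its first entry is `w₁ + w₂ = 1 -
      -- w₃`.
      rcases Nat.eq_zero_or_pos m with rfl | hm
      · simp; linarith
      · simp [show 1 ≤ m by omega]
  · have := sum_range_desc_le_of_mem_convexHull hv₁ hv₂ hl' (a := m + 2) (b := 0)
      (B := ((m + 2 : ℕ) : ℝ) - 1 + w₁) (by omega) (by omega) ?_ ?_
    · simpa using this
    · simp only [sum_vertexSeq₁]
      simp
      linarith
    · simp only [sum_vertexSeq₂]
      simp
      linarith
  · unfold LevelThreeConstraint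
    rw [show m + 2 - 1 = m + 1 by omega, levelThree_sum]
    refine sum_range_desc_le_of_mem_convexHull hv₁ hv₂ hl' (by omega) (by omega) ?_ ?_
    · simp only [sum_vertexSeq₁]
      simp
      linarith
    · simp only [sum_vertexSeq₂]
      simp
      linarith

end

/-! ### The new constraint and the extreme points -/

section
variable {m d : ℕ} {w₁ w₂ w₃ : ℝ}

theorem permutations_comp_perm {v x : Fin d → ℝ} (hx : x ∈ permutations v)
    (σ : Equiv.Perm (Fin d)) : x ∘ σ ∈ permutations v := by
  obtain ⟨τ, rfl⟩ := hx
  exact ⟨σ.trans τ, rfl⟩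

/-- The `N - 1` largest entries separate: they sum to `N - 1` for `vertex₁`, but to at most `N - 1 -
w₃` on the hull of the other orbit. -/
theorem vertex₁_notMem_convexHull (hd : m + 2 + 2 ≤ d) (h₁₂ : w₂ ≤ w₁) (h₂₃ : w₃ ≤ w₂)
    (h₃ : 0 < w₃) (hsum : w₁ + w₂ + w₃ = 1) :
    vertex₁ (m + 2) d w₁ w₂ w₃ ∉ convexHull ℝ (permutations (vertex₂ (m + 2) d w₁ w₂ w₃)) := by
  intro hl
  rw [← Set.union_self (permutations _)] at hl
  have hv₂ : Antitone (fun k : Fin d => vertexSeq₂ (m + 2) w₁ w₂ w₃ k) :=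
    antitone_vertex₂ h₁₂ h₂₃ h₃.le hsum
  have h := sum_range_desc_le_of_mem_convexHull hv₂ hv₂ hl (a := m + 1) (b := 0)
    (B := m + w₁ + w₂) (by omega) (by omega) (by simp [sum_vertexSeq₂]) (by simp [sum_vertexSeq₂])
  have h' : ∑ j ∈ Finset.range (m + 1), desc (vertex₁ (m + 2) d w₁ w₂ w₃) j
      = ∑ j ∈ Finset.range (m + 1), vertexSeq₁ (m + 2) w₁ w₂ w₃ j := by
    refine Finset.sum_congr rfl fun j hj => ?_
    have hj' := Finset.mem_range.mp hj
    exact desc_comp_perm (antitone_vertex₁ h₁₂ h₂₃ h₃.le hsum) (Equiv.refl _)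
      (⟨j, by omega⟩ : Fin d)
  rw [h', sum_vertexSeq₁] at h
  simp at h
  linarith

theorem permutations_eq_of_mem {v x : Fin d → ℝ} (hx : x ∈ permutations v) :
    permutations x = permutations v := by
  obtain ⟨τ, rfl⟩ := hx
  refine Set.Subset.antisymm ?_ ?_
  · rintro _ ⟨σ, rfl⟩
    exact ⟨σ.trans τ, rfl⟩
  · rintro _ ⟨σ, rfl⟩
    exact ⟨σ.trans τ.symm, by ext; simp⟩

/-- Here the `N + 1` largest entries separate: they sum to `N` for `vertex₂`, but to at most `N -
w₃` on the hull of the other orbit. -/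
theorem vertex₂_notMem_convexHull (hd : m + 2 + 2 ≤ d) (h₁₂ : w₂ ≤ w₁) (h₂₃ : w₃ ≤ w₂)
    (h₃ : 0 < w₃) (hsum : w₁ + w₂ + w₃ = 1) :
    vertex₂ (m + 2) d w₁ w₂ w₃ ∉ convexHull ℝ (permutations (vertex₁ (m + 2) d w₁ w₂ w₃)) := by
  intro hl
  rw [← Set.union_self (permutations _)] at hl
  have hv₁ : Antitone (fun k : Fin d => vertexSeq₁ (m + 2) w₁ w₂ w₃ k) :=
    antitone_vertex₁ h₁₂ h₂₃ h₃.le hsum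
  have h := sum_range_desc_le_of_mem_convexHull hv₁ hv₁ hl (a := m + 3) (b := 0)
    (B := m + 1 + w₁ + w₂) (by omega) (by omega) (by simp [sum_vertexSeq₁])
    (by simp [sum_vertexSeq₁])
  have h' : ∑ j ∈ Finset.range (m + 3), desc (vertex₂ (m + 2) d w₁ w₂ w₃) j
      = ∑ j ∈ Finset.range (m + 3), vertexSeq₂ (m + 2) w₁ w₂ w₃ j := by
    refine Finset.sum_congr rfl fun j hj => ?_
    have hj' := Finset.mem_range.mp hj
    exact desc_comp_perm (antitone_vertex₂ h₁₂ h₂₃ h₃.le hsum) (Equiv.refl _)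
      (⟨j, by omega⟩ : Fin d)
  rw [h', sum_vertexSeq₂] at h
  simp at h
  linarith

theorem vertex₂_eq_vertex₁ (h₃ : w₃ = 0) (hsum : w₁ + w₂ + w₃ = 1) :
    vertex₂ (m + 2) d w₁ w₂ w₃ = vertex₁ (m + 2) d w₁ w₂ w₃ := by
  ext k
  simp only [vertex₁, vertex₂]
  split_ifs <;> first | omega | linarith

theorem comp_perm_mem_convexHull_permutations {v₁ v₂ x : Fin d → ℝ}
    (hx : x ∈ convexHull ℝ (permutations v₁ ∪ permutations v₂)) (σ : Equiv.Perm (Fin d)) :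
    x ∘ σ ∈ convexHull ℝ (permutations v₁ ∪ permutations v₂) := by
  have h : x ∘ σ = LinearMap.funLeft ℝ ℝ σ x := rfl
  rw [h]
  have := Set.mem_image_of_mem (LinearMap.funLeft ℝ ℝ σ) hx
  rw [LinearMap.image_convexHull] at this
  refine convexHull_mono ?_ this
  rintro _ ⟨y, hy | hy, rfl⟩
  · exact Or.inl (permutations_comp_perm hy σ)
  · exact Or.inr (permutations_comp_perm hy σ)

theorem comp_perm_mem_extremePoints {v₁ v₂ x : Fin d → ℝ}
    (hx : x ∈ (convexHull ℝ (permutations v₁ ∪ permutations v₂)).extremePoints ℝ)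
    (σ : Equiv.Perm (Fin d)) :
    x ∘ σ ∈ (convexHull ℝ (permutations v₁ ∪ permutations v₂)).extremePoints ℝ := by
  rw [mem_extremePoints] at hx ⊢
  refine ⟨comp_perm_mem_convexHull_permutations hx.1 σ, fun y hy z hz hyz => ?_⟩
  have hyz' : x ∈ openSegment ℝ (y ∘ σ.symm) (z ∘ σ.symm) := by
    obtain ⟨a, b, ha, hb, hab, h⟩ := hyz
    refine ⟨a, b, ha, hb, hab, ?_⟩
    ext i
    simpa using congrFun h (σ.symm i)
  obtain ⟨h1, h2⟩ := hx.2 _ (comp_perm_mem_convexHull_permutations hy σ.symm) _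
    (comp_perm_mem_convexHull_permutations hz σ.symm) hyz'
  constructor
  · rw [← h1]; ext; simp
  · rw [← h2]; ext; simp

/-- Extreme points form a union of orbits, and by Krein–Milman they generate the hull. If one orbit
were absent, the other would generate everything, contrary to the assumed nonmembership. -/
theorem extremePoints_convexHull_permutations {v₁ v₂ : Fin d → ℝ}
    (h : v₂ = v₁ ∨ v₁ ∉ convexHull ℝ (permutations v₂) ∧ v₂ ∉ convexHull ℝ (permutations v₁)) :
    (convexHull ℝ (permutations v₁ ∪ permutations v₂)).extremePoints ℝ =
      permutations v₁ ∪ permutations v₂ := by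
  set P := convexHull ℝ (permutations v₁ ∪ permutations v₂) with hP
  have hfin : (permutations v₁ ∪ permutations v₂).Finite :=
    (finite_permutations _).union (finite_permutations _)
  have hsub : P.extremePoints ℝ ⊆ permutations v₁ ∪ permutations v₂ :=
    extremePoints_convexHull_subset
  have hKM : convexHull ℝ (P.extremePoints ℝ) = P := by
    have h := closure_convexHull_extremePoints (hfin.isCompact_convexHull ℝ) (convex_convexHull ℝ _)
    rwa [((hfin.subset hsub).isCompact_convexHull ℝ).isClosed.closure_eq] at h
  have hv₁ : v₁ ∈ P := subset_convexHull ℝ _ (Or.inl ⟨Equiv.refl _, rfl⟩)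
  have hv₂ : v₂ ∈ P := subset_convexHull ℝ _ (Or.inr ⟨Equiv.refl _, rfl⟩)
  have orbit : ∀ v x : Fin d → ℝ, x ∈ permutations v → x ∈ P.extremePoints ℝ →
      permutations v ⊆ P.extremePoints ℝ := by
    intro v x hx hxe
    rw [← permutations_eq_of_mem hx]
    rintro _ ⟨σ, rfl⟩
    exact comp_perm_mem_extremePoints hxe σ
  refine Set.Subset.antisymm hsub (Set.union_subset ?_ ?_)
  · by_contra hcon
    have hsub₂ : P.extremePoints ℝ ⊆ permutations v₂ := by
      intro x hx
      rcases hsub hx with h1 | h1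
      · exact absurd (orbit _ _ h1 hx) hcon
      · exact h1
    rcases h with h | h
    · subst h
      have hne : (P.extremePoints ℝ).Nonempty := by
        rw [← convexHull_nonempty_iff (𝕜 := ℝ), hKM]
        exact ⟨_, hv₁⟩
      obtain ⟨x, hx⟩ := hne
      exact hcon (orbit _ _ (hsub₂ hx) hx)
    · rw [← hKM] at hv₁
      exact h.1 (convexHull_mono hsub₂ hv₁)
  · by_contra hcon
    have hsub₂ : P.extremePoints ℝ ⊆ permutations v₁ := by
      intro x hx
      rcases hsub hx with h1 | h1
      · exact h1
      · exact absurd (orbit _ _ h1 hx) hcon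
    rcases h with h | h
    · subst h
      have hne : (P.extremePoints ℝ).Nonempty := by
        rw [← convexHull_nonempty_iff (𝕜 := ℝ), hKM]
        exact ⟨_, hv₁⟩
      obtain ⟨x, hx⟩ := hne
      exact hcon (orbit _ _ (hsub₂ hx) hx)
    · rw [← hKM] at hv₂
      exact h.2 (convexHull_mono hsub₂ hv₂)

theorem extremePoints_convexHull_vertices (hd : m + 2 + 2 ≤ d) (h₁₂ : w₂ ≤ w₁) (h₂₃ : w₃ ≤ w₂)
    (h₃ : 0 ≤ w₃) (hsum : w₁ + w₂ + w₃ = 1) :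
    (convexHull ℝ (permutations (vertex₁ (m + 2) d w₁ w₂ w₃) ∪
      permutations (vertex₂ (m + 2) d w₁ w₂ w₃))).extremePoints ℝ =
      permutations (vertex₁ (m + 2) d w₁ w₂ w₃) ∪ permutations (vertex₂ (m + 2) d w₁ w₂ w₃) := by
  refine extremePoints_convexHull_permutations ?_
  rcases h₃.eq_or_lt with h | h
  · exact Or.inl (vertex₂_eq_vertex₁ h.symm hsum)
  · exact Or.inr ⟨vertex₁_notMem_convexHull hd h₁₂ h₂₃ h hsum,
      vertex₂_notMem_convexHull hd h₁₂ h₂₃ h hsum⟩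

/-! ### Redundancy of the new constraint. -/

/-- If `w₂ = w₁`, the constraint is at most twice the bound on the `N` largest entries, since
`λ↓_{N+1} ≤ λ↓_N`. If `w₃ = 0`, it is the sum of Pauli's bound on the first `N - 1` entries and
normalisation for the first `N + 1`. -/
theorem levelThreeConstraint_of_levelTwo (hd : m + 2 + 2 ≤ d) (hsum : w₁ + w₂ + w₃ = 1)
    (h : w₂ = w₁ ∨ w₃ = 0) {l : Fin d → ℝ} (hl : LevelTwoConstraints (m + 2) w₁ l) :
    LevelThreeConstraint (m + 2) w₁ w₂ l := by
  obtain ⟨hpos, htot, hone, hN⟩ := hl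
  unfold LevelThreeConstraint
  rw [show m + 2 - 1 = m + 1 by omega]
  push_cast at hN htot ⊢
  rcases h with rfl | rfl
  · have := antitone_desc l (show (⟨m + 1, by omega⟩ : Fin d) ≤ ⟨m + 2, by omega⟩ by
      simp [Fin.le_def])
    simp only at this
    rw [Finset.sum_range_succ] at hN
    linarith
  · rw [levelThree_sum]
    have h1 := sum_range_desc_le hone (show m + 1 ≤ d by omega)
    have h2 : ∑ j ∈ Finset.range (m + 3), desc l j ≤ ∑ j ∈ Finset.range d, desc l j :=
      Finset.sum_le_sum_of_subset_of_nonneg (by simp; omega) fun j _ _ => desc_nonneg hpos j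
    rw [sum_range_desc_eq, htot] at h2
    push_cast at h1
    linarith

/-- A witness against the new constraint when the largest weight is at least one half is a vertex
of the two-weight polytope; otherwise it is of the form `(1, …, 1, 2w₁, 1 - w₁, 1 - w₁, 0, …)`. -/
theorem exists_not_levelThreeConstraint (hd : m + 2 + 2 ≤ d) (h₂₃ : w₃ ≤ w₂)
    (hsum : w₁ + w₂ + w₃ = 1) (h₁₂ : w₂ < w₁) (h₃ : 0 < w₃) :
    ∃ l : Fin d → ℝ, LevelTwoConstraints (m + 2) w₁ l ∧
      ¬ LevelThreeConstraint (m + 2) w₁ w₂ l := by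
  -- After `m` ones the entries are `x, y, z` with total two, so the left side of the new constraint
  -- is `2m + 2 + x`, and violation means exactly `w₁ + w₂ < x`. Both choices saturate `x + y = 1 +
  -- w₁`.
  obtain ⟨x, y, z, hu1, hu, hu0, hneg⟩ : ∃ x y z : ℝ, x ≤ 1 ∧ (y ≤ x ∧ z ≤ y ∧ 0 ≤ z) ∧
      (x + y + z = 2 ∧ x + y ≤ 1 + w₁) ∧ w₁ + w₂ < x := by
    rcases le_total (1 / 2) w₁ with h | h
    · exact ⟨1, w₁, 1 - w₁, le_rfl, ⟨by linarith, by linarith, by linarith⟩,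
        ⟨by linarith, by linarith⟩, by linarith⟩
    · exact ⟨2 * w₁, 1 - w₁, 1 - w₁, by linarith, ⟨by linarith, by linarith, by linarith⟩,
        ⟨by linarith, by linarith⟩, by linarith⟩
  let s : ℕ → ℝ := fun k => if k < m then 1 else if k = m then x else if k = m + 1 then y
    else if k = m + 2 then z else 0
  have hs : ∀ k, ∑ j ∈ Finset.range k, s j = if k ≤ m then (k : ℝ) else if k = m + 1 then m + x
      else if k = m + 2 then m + x + y else m + x + y + z := by
    intro k
    induction k with
    | zero => simp
    | succ k ih =>
      rw [Finset.sum_range_succ, ih]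
      simp only [s]
      rcases lt_or_ge k m with h | h
      · simp [show k ≤ m by omega, show k + 1 ≤ m by omega, show k < m by omega]
      · obtain ⟨e, rfl⟩ := Nat.exists_eq_add_of_le h
        rcases e with _ | _ | _ | e
        · simp
        · simp
        · simp
        · simp
  have hanti : Antitone fun k : Fin d => s k := by
    intro a b hab
    have : (a : ℕ) ≤ b := hab
    simp only [s]
    split_ifs <;> first | omega | linarith
  have hdesc : ∀ k, k < d → desc (fun k : Fin d => s k) k = s k := fun k hk =>
    desc_comp_perm hanti (Equiv.refl _) ⟨k, hk⟩
  have hsumd : ∀ k, k ≤ d → ∑ j ∈ Finset.range k, desc (fun k : Fin d => s k) j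
      = ∑ j ∈ Finset.range k, s j := fun k hk =>
    Finset.sum_congr rfl fun j hj => hdesc j (by have := Finset.mem_range.mp hj; omega)
  refine ⟨fun k => s k, ⟨fun i => ?_, ?_, ?_, ?_⟩, ?_⟩
  · simp only [s]
    split_ifs <;> linarith
  · rw [Fin.sum_univ_eq_sum_range s d, hs, if_neg (by omega), if_neg (by omega), if_neg (by omega)]
    push_cast
    linarith
  · rw [hdesc 0 (by omega)]
    simp only [s]
    split_ifs <;> linarith
  · rw [hsumd _ (by omega), hs, if_neg (by omega), if_neg (by omega), if_pos rfl]
    push_cast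
    linarith
  · unfold LevelThreeConstraint
    rw [show m + 2 - 1 = m + 1 by omega, levelThree_sum, hsumd _ (by omega), hsumd _ (by omega),
      hs, hs, if_neg (by omega), if_pos rfl, if_neg (by omega), if_neg (by omega),
      if_neg (by omega)]
    push_cast
    linarith

end

/-! ### Lowest configurations -/

section
variable {m d : ℕ}

theorem le_config_apply {N : ℕ} (i : Config N d) (j : Fin N) : (j : ℕ) ≤ i j := by
  obtain ⟨j, hj⟩ := j
  induction j with
  | zero => simp
  | succ j ih =>
    have h1 := ih (by omega)
    have h2 : i ⟨j, by omega⟩ < i ⟨j + 1, hj⟩ := i.strictMono (by simp [Fin.lt_def])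
    have h3 : (i ⟨j, by omega⟩ : ℕ) < i ⟨j + 1, hj⟩ := h2
    simp only at h1 ⊢
    omega

theorem config_apply_add_le {N : ℕ} (i : Config N d) {j k : Fin N} (hjk : j ≤ k) :
    (i j : ℕ) + (k - j : ℕ) ≤ i k := by
  obtain ⟨k, hk⟩ := k
  induction k with
  | zero =>
    have : j = ⟨0, hk⟩ := le_antisymm hjk (by simp [Fin.le_def])
    simp [this]
  | succ k ih =>
    rcases hjk.eq_or_lt with rfl | h
    · simp
    · have h0 : (j : ℕ) < k + 1 := h
      have h1 := ih (by omega) (by simp [Fin.le_def]; omega)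
      have h2 : i ⟨k, by omega⟩ < i ⟨k + 1, hk⟩ := i.strictMono (by simp [Fin.lt_def])
      have h3 : (i ⟨k, by omega⟩ : ℕ) < i ⟨k + 1, hk⟩ := h2
      simp only at h1 ⊢
      omega

theorem coe_configGround (hd : m + 2 + 2 ≤ d) (j : Fin (m + 2)) :
    (configGround hd j : ℕ) = j := rfl

theorem coe_configFirst (hd : m + 2 + 2 ≤ d) (j : Fin (m + 2)) :
    (configFirst hd j : ℕ) = if m + 2 ≤ (j : ℕ) + 1 then (j + 1 : ℕ) else j := rfl

theorem coe_configA (hd : m + 2 + 2 ≤ d) (j : Fin (m + 2)) :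
    (configA hd j : ℕ) = if m + 2 ≤ (j : ℕ) + 1 then (j + 2 : ℕ) else j := rfl

theorem coe_configB (hd : m + 2 + 2 ≤ d) (j : Fin (m + 2)) :
    (configB hd j : ℕ) = if m + 2 ≤ (j : ℕ) + 2 then (j + 1 : ℕ) else j := rfl

theorem config_ext {N : ℕ} {i k : Config N d} (h : ∀ j, (i j : ℕ) = k j) : i = k :=
  RelEmbedding.ext fun j => Fin.ext (h j)

/-- If the last orbital were below `m + 2` (counting from zero), strict monotonicity would squeeze
every entry onto the ground configuration. -/
theorem configFirst_le (hd : m + 2 + 2 ≤ d) {i : Config (m + 2) d} (hi : i ≠ configGround hd)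
    (j : Fin (m + 2)) : configFirst hd j ≤ i j := by
  have hlast : m + 2 ≤ (i (Fin.last (m + 1)) : ℕ) := by
    by_contra hcon
    refine hi (config_ext fun j => ?_)
    have h1 := le_config_apply i j
    have h2 := config_apply_add_le i (Fin.le_last j)
    rw [coe_configGround]
    simp only [Fin.val_last] at h2
    omega
  rw [Fin.le_def, coe_configFirst]
  split_ifs with h
  · have : j = Fin.last (m + 1) := Fin.ext (by simp only [Fin.val_last]; omega)
    subst this
    exact hlast
  · exact le_config_apply i j

/-- A last orbital beyond `m + 2` gives `configA`. If it equals `m + 2`, the preceding orbital must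
have moved up too, since otherwise the configuration is `configFirst`; this gives `configB`. -/
theorem configA_or_configB_le (hd : m + 2 + 2 ≤ d) {i : Config (m + 2) d}
    (hi : i ≠ configGround hd) (hi' : i ≠ configFirst hd) :
    (∀ j, configA hd j ≤ i j) ∨ (∀ j, configB hd j ≤ i j) := by
  have hlast := configFirst_le hd hi (Fin.last (m + 1))
  rw [Fin.le_def, coe_configFirst] at hlast
  simp only [Fin.val_last, le_refl, if_true] at hlast
  rcases Nat.lt_or_ge (m + 2) (i (Fin.last (m + 1))) with h | h
  · left
    intro j
    rw [Fin.le_def, coe_configA]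
    split_ifs with h'
    · have : j = Fin.last (m + 1) := Fin.ext (by simp only [Fin.val_last]; omega)
      subst this
      exact h
    · exact le_config_apply i j
  · right
    have hpen : m + 1 ≤ (i ⟨m, by omega⟩ : ℕ) := by
      by_contra hcon
      refine hi' (config_ext fun j => ?_)
      rw [coe_configFirst]
      split_ifs with h'
      · have : j = Fin.last (m + 1) := Fin.ext (by simp only [Fin.val_last]; omega)
        subst this
        simp only [Fin.val_last]
        omega
      · have h1 := le_config_apply i j
        have h2 := config_apply_add_le i (show j ≤ ⟨m, by omega⟩ by simp [Fin.le_def]; omega)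
        simp only at h2
        omega
    intro j
    rw [Fin.le_def, coe_configB]
    split_ifs with h'
    · rcases (show (j : ℕ) = m ∨ (j : ℕ) = m + 1 by omega) with hj | hj
      · have : j = ⟨m, by omega⟩ := Fin.ext hj
        rw [this]
        exact hpen
      · have : j = Fin.last (m + 1) := Fin.ext hj
        subst this
        simp only [Fin.val_last]
        omega
    · exact le_config_apply i j

theorem energy_le_energy {N : ℕ} {h : Fin d → ℝ} (hh : Monotone h) {i k : Config N d}
    (hik : ∀ j, i j ≤ k j) : energy h i ≤ energy h k :=
  Finset.sum_le_sum fun j _ => hh (hik j)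

theorem energy_lt_energy {N : ℕ} {h : Fin d → ℝ} (hh : StrictMono h) {i k : Config N d}
    (hik : ∀ j, i j ≤ k j) (hne : i ≠ k) : energy h i < energy h k := by
  refine Finset.sum_lt_sum (fun j _ => hh.monotone (hik j)) ?_
  by_contra hcon
  push Not at hcon
  refine hne (RelEmbedding.ext fun j => ?_)
  exact hh.injective (le_antisymm (hh.monotone (hik j)) (hcon j (Finset.mem_univ j)))

theorem configGround_le (hd : m + 2 + 2 ≤ d) (i : Config (m + 2) d) (j : Fin (m + 2)) :
    configGround hd j ≤ i j := le_config_apply i j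

theorem configGround_ne_configFirst (hd : m + 2 + 2 ≤ d) :
    (configGround hd : Config (m + 2) d) ≠ configFirst hd := fun h => by
  have := congrArg (fun i : Config (m + 2) d => (i (Fin.last (m + 1)) : ℕ)) h
  simp [coe_configGround, coe_configFirst] at this

theorem configGround_ne_configA (hd : m + 2 + 2 ≤ d) :
    (configGround hd : Config (m + 2) d) ≠ configA hd := fun h => by
  have := congrArg (fun i : Config (m + 2) d => (i (Fin.last (m + 1)) : ℕ)) h
  simp [coe_configGround, coe_configA] at this

theorem configGround_ne_configB (hd : m + 2 + 2 ≤ d) :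
    (configGround hd : Config (m + 2) d) ≠ configB hd := fun h => by
  have := congrArg (fun i : Config (m + 2) d => (i (Fin.last (m + 1)) : ℕ)) h
  simp [coe_configGround, coe_configB] at this

theorem configFirst_ne_configA (hd : m + 2 + 2 ≤ d) :
    (configFirst hd : Config (m + 2) d) ≠ configA hd := fun h => by
  have := congrArg (fun i : Config (m + 2) d => (i (Fin.last (m + 1)) : ℕ)) h
  simp [coe_configFirst, coe_configA] at this

theorem configFirst_ne_configB (hd : m + 2 + 2 ≤ d) :
    (configFirst hd : Config (m + 2) d) ≠ configB hd := fun h => by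
  have := congrArg (fun i : Config (m + 2) d => (i ⟨m, by omega⟩ : ℕ)) h
  simp [coe_configFirst, coe_configB] at this

theorem isLowestThree_configA (hd : m + 2 + 2 ≤ d) {h : Fin d → ℝ} (hh : Monotone h)
    (hAB : energy h (configA hd : Config (m + 2) d) ≤ energy h (configB hd)) :
    IsLowestThree h (configGround hd : Config (m + 2) d) (configFirst hd) (configA hd) := by
  refine ⟨configGround_ne_configFirst hd, configGround_ne_configA hd, configFirst_ne_configA hd,
    energy_le_energy hh (configGround_le hd _),
    energy_le_energy hh (configFirst_le hd (configGround_ne_configA hd).symm), fun i h1 h2 _ => ?_⟩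
  rcases configA_or_configB_le hd h1 h2 with h3 | h3
  · exact energy_le_energy hh h3
  · exact hAB.trans (energy_le_energy hh h3)

theorem isLowestThree_configB (hd : m + 2 + 2 ≤ d) {h : Fin d → ℝ} (hh : Monotone h)
    (hBA : energy h (configB hd : Config (m + 2) d) ≤ energy h (configA hd)) :
    IsLowestThree h (configGround hd : Config (m + 2) d) (configFirst hd) (configB hd) := by
  refine ⟨configGround_ne_configFirst hd, configGround_ne_configB hd, configFirst_ne_configB hd,
    energy_le_energy hh (configGround_le hd _),
    energy_le_energy hh (configFirst_le hd (configGround_ne_configB hd).symm), fun i h1 h2 _ => ?_⟩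
  rcases configA_or_configB_le hd h1 h2 with h3 | h3
  · exact hBA.trans (energy_le_energy hh h3)
  · exact energy_le_energy hh h3

/-- For strictly increasing levels, strict componentwise dominance is a strict energy gap, so any
other choice leaves a configuration that is too low. -/
theorem eq_of_isLowestThree (hd : m + 2 + 2 ≤ d) {h : Fin d → ℝ} (hh : StrictMono h)
    {i₁ i₂ i₃ : Config (m + 2) d} (hi : IsLowestThree h i₁ i₂ i₃) :
    i₁ = configGround hd ∧ i₂ = configFirst hd ∧ (i₃ = configA hd ∨ i₃ = configB hd) := by
  obtain ⟨h12, h13, h23, e12, e23, hlow⟩ := hi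
  have hg : i₁ = configGround hd := by
    by_contra hne
    have hlt := energy_lt_energy hh (configGround_le hd i₁) (Ne.symm hne)
    by_cases h2 : configGround hd = i₂
    · rw [h2] at hlt; linarith
    by_cases h3 : configGround hd = i₃
    · rw [h3] at hlt; linarith
    have := hlow _ (Ne.symm hne) h2 h3
    linarith
  subst hg
  have hf : i₂ = configFirst hd := by
    by_contra hne
    have hlt := energy_lt_energy hh (configFirst_le hd (Ne.symm h12)) (Ne.symm hne)
    by_cases h3 : configFirst hd = i₃
    · rw [h3] at hlt; linarith
    have := hlow _ (configGround_ne_configFirst hd).symm (Ne.symm hne) h3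
    linarith
  subst hf
  refine ⟨rfl, rfl, ?_⟩
  by_contra hne
  push Not at hne
  rcases configA_or_configB_le hd (Ne.symm h13) (Ne.symm h23) with h3 | h3
  · have h4 := energy_lt_energy hh h3 (Ne.symm hne.1)
    have := hlow _ (configGround_ne_configA hd).symm (configFirst_ne_configA hd).symm (Ne.symm hne.1)
    linarith
  · have h4 := energy_lt_energy hh h3 (Ne.symm hne.2)
    have := hlow _ (configGround_ne_configB hd).symm (configFirst_ne_configB hd).symm (Ne.symm hne.2)
    linarith

theorem energy_configA_sub_energy_configB (hd : m + 2 + 2 ≤ d) (h : ℕ → ℝ) :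
    energy (fun k : Fin d => h k) (configA hd : Config (m + 2) d)
      - energy (fun k : Fin d => h k) (configB hd)
      = h m + h (m + 3) - h (m + 1) - h (m + 2) := by
  unfold energy
  rw [Fin.sum_univ_castSucc, Fin.sum_univ_castSucc, Fin.sum_univ_castSucc, Fin.sum_univ_castSucc]
  have : ∀ j : Fin m, h (configA hd j.castSucc.castSucc : ℕ)
      = h (configB hd j.castSucc.castSucc : ℕ) := by
    intro j
    rw [coe_configA, coe_configB]
    have := j.2
    simp only [Fin.val_castSucc]
    rw [if_neg (by omega), if_neg (by omega)]
  simp only [this]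
  simp only [coe_configA, coe_configB, Fin.val_castSucc, Fin.val_last]
  norm_num
  ring

theorem exists_energy_configA_lt (hd : m + 2 + 2 ≤ d) : ∃ h : Fin d → ℝ, StrictMono h ∧
    energy h (configA hd : Config (m + 2) d) < energy h (configB hd) := by
  -- A unit widening of the gap just above level `m` makes the energy difference equal to `-1`.
  let h : ℕ → ℝ := fun k => if k ≤ m then (k : ℝ) - 1 else k
  refine ⟨fun k => h k, fun a b hab => ?_, ?_⟩
  · have h1 : (a : ℕ) < b := hab
    have h2 : ((a : ℕ) : ℝ) < (b : ℕ) := by exact_mod_cast h1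
    simp only [h]
    split_ifs <;> first | omega | linarith
  · have := energy_configA_sub_energy_configB hd h
    simp [h] at this ⊢
    linarith

theorem exists_energy_configB_lt (hd : m + 2 + 2 ≤ d) : ∃ h : Fin d → ℝ, StrictMono h ∧
    energy h (configB hd : Config (m + 2) d) < energy h (configA hd) := by
  -- A unit widening of the gap just above level `m + 2` makes the energy difference equal to `1`.
  let h : ℕ → ℝ := fun k => if k ≤ m + 2 then (k : ℝ) else k + 1
  refine ⟨fun k => h k, fun a b hab => ?_, ?_⟩
  · have h1 : (a : ℕ) < b := hab
    have h2 : ((a : ℕ) : ℝ) < (b : ℕ) := by exact_mod_cast h1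
    simp only [h]
    split_ifs <;> first | omega | linarith
  · have := energy_configA_sub_energy_configB hd h
    simp [h] at this ⊢
    linarith

end

/-! ### Slater determinants and antisymmetric wave functions -/

section
variable {N d : ℕ}

theorem apply_comp_perm (ψ : fermionSpace N d) (σ : Equiv.Perm (Fin N)) (x : Fin N → Fin d) :
    (ψ : EuclideanSpace ℂ (Fin N → Fin d)) (x ∘ σ)
      = ((Equiv.Perm.sign σ : ℤ) : ℂ) * (ψ : EuclideanSpace ℂ (Fin N → Fin d)) x :=
  ψ.2 σ x

theorem norm_apply_comp_perm (ψ : fermionSpace N d) (σ : Equiv.Perm (Fin N)) (x : Fin N → Fin d) :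
    ‖(ψ : EuclideanSpace ℂ (Fin N → Fin d)) (x ∘ σ)‖
      = ‖(ψ : EuclideanSpace ℂ (Fin N → Fin d)) x‖ := by
  rw [apply_comp_perm, norm_mul]
  rcases Int.units_eq_one_or (Equiv.Perm.sign σ) with h | h <;> simp [h]

theorem apply_eq_zero_of_not_injective (ψ : fermionSpace N d) {x : Fin N → Fin d}
    (hx : ¬ Function.Injective x) : (ψ : EuclideanSpace ℂ (Fin N → Fin d)) x = 0 := by
  simp only [Function.Injective, not_forall] at hx
  obtain ⟨j, k, hjk, hne⟩ := hx
  have h := apply_comp_perm ψ (Equiv.swap j k) x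
  have hx' : x ∘ Equiv.swap j k = x := by
    ext l
    simp only [Function.comp_apply]
    rcases eq_or_ne l j with rfl | h1
    · rw [Equiv.swap_apply_left, hjk]
    rcases eq_or_ne l k with rfl | h2
    · rw [Equiv.swap_apply_right, hjk]
    rw [Equiv.swap_apply_of_ne_of_ne h1 h2]
  rw [hx', Equiv.Perm.sign_swap hne] at h
  simp only [Units.val_neg, Units.val_one, Int.cast_neg, Int.cast_one, neg_mul, one_mul] at h
  exact self_eq_neg.mp h

theorem comp_perm_eq_iff {x y : Fin N → Fin d} (τ : Equiv.Perm (Fin N)) :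
    x ∘ τ = y ↔ x = y ∘ τ.symm := by
  constructor <;> rintro rfl <;> ext <;> simp

theorem slater_apply (i : Config N d) (x : Fin N → Fin d) :
    (slater i : EuclideanSpace ℂ (Fin N → Fin d)) x =
      ((Real.sqrt (Nat.factorial N) : ℝ) : ℂ)⁻¹ * ∑ τ : Equiv.Perm (Fin N),
        ((Equiv.Perm.sign τ : ℤ) : ℂ) * if x ∘ τ = i then 1 else 0 := by
  change _ * Matrix.det _ = _
  rw [Matrix.det_apply']
  congr 1
  refine Finset.sum_congr rfl fun τ _ => ?_
  congr 1
  simp only [Matrix.of_apply]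
  rw [Finset.prod_ite_zero]
  simp [funext_iff]

theorem sqrt_factorial_mul_inv_mul (N : ℕ) : ((Real.sqrt (Nat.factorial N) : ℝ) : ℂ)⁻¹ *
    (Nat.factorial N : ℂ) = ((Real.sqrt (Nat.factorial N) : ℝ) : ℂ) := by
  have h : (0 : ℝ) < Nat.factorial N := by exact_mod_cast Nat.factorial_pos N
  have h0 : ((Real.sqrt (Nat.factorial N) : ℝ) : ℂ) ≠ 0 := by
    exact_mod_cast (Real.sqrt_pos.mpr h).ne'
  have h1 : (Nat.factorial N : ℂ) = ((Real.sqrt (Nat.factorial N) : ℝ) : ℂ) *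
      ((Real.sqrt (Nat.factorial N) : ℝ) : ℂ) := by
    rw [← Complex.ofReal_mul, Real.mul_self_sqrt h.le]
    simp
  rw [h1, inv_mul_cancel_left₀ h0]

/-- By antisymmetry the `N!` terms of the determinant contribute equally, the sign of each
permutation cancelling. -/
theorem inner_slater (i : Config N d) (ψ : fermionSpace N d) :
    inner ℂ (slater i) ψ = ((Real.sqrt (Nat.factorial N) : ℝ) : ℂ) *
      (ψ : EuclideanSpace ℂ (Fin N → Fin d)) i := by
  rw [Submodule.coe_inner, PiLp.inner_apply]
  simp only [RCLike.inner_apply, slater_apply, map_mul, map_inv₀, Complex.conj_ofReal, map_sum,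
    map_intCast]
  simp only [apply_ite (starRingEnd ℂ), map_one, map_zero, comp_perm_eq_iff]
  simp_rw [Finset.mul_sum]
  rw [Finset.sum_comm]
  have : ∀ τ : Equiv.Perm (Fin N), ∑ x : Fin N → Fin d,
      (ψ : EuclideanSpace ℂ (Fin N → Fin d)) x * (((Real.sqrt (Nat.factorial N) : ℝ) : ℂ)⁻¹ *
        (((Equiv.Perm.sign τ : ℤ) : ℂ) * if x = i ∘ τ.symm then 1 else 0))
      = ((Real.sqrt (Nat.factorial N) : ℝ) : ℂ)⁻¹ *
        (ψ : EuclideanSpace ℂ (Fin N → Fin d)) i := by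
    intro τ
    simp only [mul_ite, mul_one, mul_zero, Finset.sum_ite_eq', Finset.mem_univ, if_true]
    rw [apply_comp_perm, Equiv.Perm.sign_symm]
    rcases Int.units_eq_one_or (Equiv.Perm.sign τ) with h | h <;> simp [h, mul_comm]
  simp only [this, Finset.sum_const, Finset.card_univ, Fintype.card_perm, Fintype.card_fin,
    nsmul_eq_mul]
  rw [← mul_assoc, mul_comm (Nat.factorial N : ℂ), sqrt_factorial_mul_inv_mul]

theorem norm_inner_slater_sq (i : Config N d) (ψ : fermionSpace N d) :
    ‖inner ℂ (slater i) ψ‖ ^ 2 = (Nat.factorial N : ℝ) *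
      ‖(ψ : EuclideanSpace ℂ (Fin N → Fin d)) i‖ ^ 2 := by
  rw [inner_slater, norm_mul, mul_pow, Complex.norm_real, Real.norm_eq_abs, sq_abs,
    Real.sq_sqrt (Nat.cast_nonneg _)]

theorem eq_of_comp_perm_eq {i k : Config N d} {τ : Equiv.Perm (Fin N)} (h : k ∘ τ = i) :
    τ = 1 ∧ k = i := by
  have hτ : StrictMono τ := fun a b hab => by
    have := i.strictMono hab
    rw [← h] at this
    exact k.strictMono.lt_iff_lt.mp this
  have h1 : τ = 1 := by
    ext a
    have := congrFun (hτ.range_inj strictMono_id |>.mp (by simp [τ.surjective.range_eq])) a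
    simp [this]
  subst h1
  exact ⟨rfl, RelEmbedding.ext fun j => congrFun h j⟩

theorem slater_apply_config (i k : Config N d) :
    (slater i : EuclideanSpace ℂ (Fin N → Fin d)) k =
      if k = i then ((Real.sqrt (Nat.factorial N) : ℝ) : ℂ)⁻¹ else 0 := by
  rw [slater_apply]
  split_ifs with h
  · subst h
    rw [Finset.sum_eq_single 1]
    · simp
    · intro τ _ hτ
      rw [if_neg fun hc => hτ (eq_of_comp_perm_eq hc).1, mul_zero]
    · simp
  · rw [Finset.sum_eq_zero, mul_zero]
    intro τ _
    rw [if_neg fun hc => h (eq_of_comp_perm_eq hc).2, mul_zero]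

theorem inner_slater_slater (i k : Config N d) :
    inner ℂ (slater i) (slater k) = if i = k then (1 : ℂ) else 0 := by
  rw [inner_slater, slater_apply_config]
  split_ifs
  · refine mul_inv_cancel₀ ?_
    have h : (0 : ℝ) < Nat.factorial N := by exact_mod_cast Nat.factorial_pos N
    exact_mod_cast (Real.sqrt_pos.mpr h).ne'
  · simp

theorem orthonormal_slater : Orthonormal ℂ (slater : Config N d → fermionSpace N d) :=
  orthonormal_iff_ite.mpr inner_slater_slater

/-- A sum over all tuples of a symmetric function that vanishes on tuples with repeated entries
is a sum over configurations. -/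
theorem sum_eq_factorial_mul_sum_config (F : (Fin N → Fin d) → ℝ)
    (hF : ∀ (σ : Equiv.Perm (Fin N)) x, F (x ∘ σ) = F x)
    (hF₀ : ∀ x, ¬ Function.Injective x → F x = 0) :
    ∑ x, F x = (Nat.factorial N : ℝ) * ∑ i : Config N d, F i := by
  have h : ∑ p : Config N d × Equiv.Perm (Fin N), F p.1 = ∑ x, F x := by
    refine Finset.sum_of_injOn (fun p => p.1 ∘ p.2) ?_ (by simp) ?_ ?_
    · rintro ⟨i, σ⟩ _ ⟨k, τ⟩ _ h
      simp only at h
      have h' : k ∘ (σ.symm.trans τ) = i := by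
        ext j
        have := congrFun h (σ.symm j)
        simp only [Function.comp_apply, Equiv.apply_symm_apply] at this
        simp [this]
      obtain ⟨h1, h2⟩ := eq_of_comp_perm_eq h'
      refine Prod.ext h2.symm ?_
      ext j
      have := congrArg (fun π : Equiv.Perm (Fin N) => π (σ j)) h1
      simp at this
      simp [this]
    · intro x _ hx
      refine hF₀ x fun hinj => hx ?_
      have hm : StrictMono (x ∘ Tuple.sort x) :=
        (Tuple.monotone_sort x).strictMono_of_injective (hinj.comp (Tuple.sort x).injective)
      refine ⟨(OrderEmbedding.ofStrictMono _ hm, (Tuple.sort x).symm), by simp, ?_⟩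
      ext j
      simp
    · rintro ⟨i, σ⟩ _
      exact (hF σ i).symm
  rw [← h, Fintype.sum_prod_type]
  simp [Finset.mul_sum, Fintype.card_perm]

/-- With `f = 1` this is Parseval, hence completeness of the Slater determinants; with `f x = ∑ h (x
j)` it gives the one-body energy. -/
theorem sum_norm_inner_slater_sq_mul (ψ : fermionSpace N d) (f : (Fin N → Fin d) → ℝ)
    (hf : ∀ (σ : Equiv.Perm (Fin N)) x, f (x ∘ σ) = f x) :
    ∑ i : Config N d, ‖inner ℂ (slater i) ψ‖ ^ 2 * f i =
      ∑ x, ‖(ψ : EuclideanSpace ℂ (Fin N → Fin d)) x‖ ^ 2 * f x := by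
  rw [sum_eq_factorial_mul_sum_config
    (fun x => ‖(ψ : EuclideanSpace ℂ (Fin N → Fin d)) x‖ ^ 2 * f x), Finset.mul_sum]
  · refine Finset.sum_congr rfl fun i _ => ?_
    rw [norm_inner_slater_sq, mul_assoc]
  · intro σ x
    simp only [norm_apply_comp_perm, hf]
  · intro x hx
    simp [apply_eq_zero_of_not_injective ψ hx]

theorem sum_norm_inner_slater_sq (ψ : fermionSpace N d) :
    ∑ i : Config N d, ‖inner ℂ (slater i) ψ‖ ^ 2 = ‖ψ‖ ^ 2 := by
  have h := sum_norm_inner_slater_sq_mul ψ (fun _ => 1) (fun _ _ => rfl)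
  simp only [mul_one] at h
  rw [h, Submodule.coe_norm, EuclideanSpace.norm_sq_eq]

/-! ### One-particle reduced density matrices of pure states -/

/-- The one-particle reduced density matrix of a wave function. -/
def pureRDM [NeZero N] (ψ : EuclideanSpace ℂ (Fin N → Fin d)) : Matrix (Fin d) (Fin d) ℂ :=
  Matrix.of fun a b => (N : ℂ) * ∑ x : Fin N → Fin d with x 0 = a,
    ψ x * starRingEnd ℂ (ψ (Function.update x 0 b))

theorem pureRDM_diag [NeZero N] (ψ : EuclideanSpace ℂ (Fin N → Fin d)) (a : Fin d) :
    pureRDM ψ a a = (((N : ℝ) * ∑ x : Fin N → Fin d with x 0 = a, ‖ψ x‖ ^ 2 : ℝ) : ℂ) := by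
  simp only [pureRDM, Matrix.of_apply]
  push_cast
  congr 1
  refine Finset.sum_congr rfl fun x hx => ?_
  have hx' : x 0 = a := (Finset.mem_filter.mp hx).2
  rw [← hx', Function.update_eq_self, Complex.mul_conj']

theorem sum_mul_pureRDM_diag [NeZero N] (ψ : fermionSpace N d) (h : Fin d → ℝ) :
    ∑ a, h a * (pureRDM (ψ : EuclideanSpace ℂ (Fin N → Fin d)) a a).re =
      ∑ i : Config N d, ‖inner ℂ (slater i) ψ‖ ^ 2 * energy h i := by
  have h1 := sum_norm_inner_slater_sq_mul ψ (fun x => ∑ j, h (x j))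
    (fun σ x => Equiv.sum_comp σ fun j => h (x j))
  unfold energy
  rw [h1]
  simp_rw [pureRDM_diag, Complex.ofReal_re, Finset.mul_sum]
  -- By antisymmetry all particles contribute equally; this accounts for the factor `N` in the
  -- reduced density matrix.
  have h2 : ∀ j : Fin N, ∑ x, ‖(ψ : EuclideanSpace ℂ (Fin N → Fin d)) x‖ ^ 2 * h (x j)
      = ∑ x, ‖(ψ : EuclideanSpace ℂ (Fin N → Fin d)) x‖ ^ 2 * h (x 0) := by
    intro j
    rw [← Equiv.sum_comp ((Equiv.swap 0 j).arrowCongr (Equiv.refl (Fin d)))]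
    refine Finset.sum_congr rfl fun x _ => ?_
    have : (Equiv.swap 0 j).arrowCongr (Equiv.refl (Fin d)) x = x ∘ Equiv.swap 0 j := by
      ext; simp
    rw [this, norm_apply_comp_perm]
    simp
  rw [Finset.sum_comm (s := Finset.univ) (t := Finset.univ (α := Fin N))]
  rw [Finset.sum_congr rfl fun j _ => h2 j]
  simp only [Finset.sum_const, Finset.card_univ, Fintype.card_fin, nsmul_eq_mul]
  rw [← Finset.sum_fiberwise Finset.univ (fun x : Fin N → Fin d => x 0), Finset.mul_sum]
  refine Finset.sum_congr rfl fun a _ => ?_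
  rw [Finset.mul_sum]
  refine Finset.sum_congr rfl fun x hx => ?_
  rw [(Finset.mem_filter.mp hx).2]
  ring

theorem pureRDM_slater [NeZero N] (i : Config N d) :
    pureRDM (slater i : EuclideanSpace ℂ (Fin N → Fin d)) =
      Matrix.diagonal fun a => (energy (Pi.single a 1) i : ℂ) := by
  ext a b
  rcases eq_or_ne a b with rfl | hab
  · rw [Matrix.diagonal_apply_eq, pureRDM_diag, Complex.ofReal_inj]
    have h := sum_mul_pureRDM_diag (slater i) (Pi.single a 1)
    simp only [inner_slater_slater, Pi.single_apply, ite_mul, one_mul, zero_mul,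
      Finset.sum_ite_eq', Finset.mem_univ, if_true, pureRDM_diag, Complex.ofReal_re] at h
    rw [h, Finset.sum_eq_single i]
    · simp
    · intro k _ hk
      simp [hk]
    · simp
  · rw [Matrix.diagonal_apply_ne _ hab]
    simp only [pureRDM, Matrix.of_apply]
    rw [Finset.sum_eq_zero, mul_zero]
    intro x hx
    have hx' : x 0 = a := (Finset.mem_filter.mp hx).2
    by_contra hne
    obtain ⟨h1, h2⟩ := mul_ne_zero_iff.mp hne
    have h2' : (slater i : EuclideanSpace ℂ (Fin N → Fin d)) (Function.update x 0 b) ≠ 0 :=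
      fun h => h2 (by rw [h, map_zero])
    have hinj : Function.Injective x := by
      by_contra hc
      exact h1 (apply_eq_zero_of_not_injective _ hc)
    have hrange : ∀ y : Fin N → Fin d,
        (slater i : EuclideanSpace ℂ (Fin N → Fin d)) y ≠ 0 → Set.range y = Set.range i := by
      intro y hy
      by_contra hc
      refine hy ?_
      rw [slater_apply, Finset.sum_eq_zero, mul_zero]
      intro τ _
      rw [if_neg, mul_zero]
      intro hτ
      refine hc ?_
      rw [← hτ, τ.surjective.range_comp]
    -- Two tuples in the support of one determinant occupy the same orbitals, so replacing `a` by a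
    -- different `b` would leave `a` occupied at a second position, contradicting injectivity.
    have ha : a ∈ Set.range (Function.update x 0 b) := by
      rw [hrange _ h2', ← hrange _ h1]
      exact ⟨0, hx'⟩
    obtain ⟨j, hj⟩ := ha
    rcases eq_or_ne j 0 with rfl | h0
    · rw [Function.update_self] at hj
      exact hab hj.symm
    · rw [Function.update_of_ne h0, ← hx'] at hj
      exact h0 (hinj hj)

/-! ### Kernels and spectral decompositions -/

theorem kernel_rankOne (ψ φ : fermionSpace N d) (x y : Fin N → Fin d) :
    kernel (InnerProductSpace.rankOne ℂ ψ φ).toLinearMap x y =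
      (ψ : EuclideanSpace ℂ (Fin N → Fin d)) x *
        starRingEnd ℂ ((φ : EuclideanSpace ℂ (Fin N → Fin d)) y) := by
  have h : inner ℂ φ ((fermionSpace N d).orthogonalProjectionOnto (EuclideanSpace.single y 1))
      = starRingEnd ℂ ((φ : EuclideanSpace ℂ (Fin N → Fin d)) y) := by
    rw [Submodule.inner_orthogonalProjectionOnto_eq_of_mem_left, EuclideanSpace.inner_single_right,
      one_mul]
  simp only [kernel, ContinuousLinearMap.coe_coe, InnerProductSpace.rankOne_apply, h]
  simp [mul_comm]

theorem kernel_sum {ι : Type*} (s : Finset ι) (T : ι → FermionOp N d) (x y : Fin N → Fin d) :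
    kernel (∑ k ∈ s, T k) x y = ∑ k ∈ s, kernel (T k) x y := by
  simp [kernel, LinearMap.sum_apply]

theorem kernel_smul (c : ℂ) (T : FermionOp N d) (x y : Fin N → Fin d) :
    kernel (c • T) x y = c * kernel T x y := by
  simp [kernel]

theorem oneRDM_sum_rankOne [NeZero N] {ι : Type*} [Fintype ι] (c : ι → ℂ)
    (b : ι → fermionSpace N d) :
    oneRDM (∑ k, c k • (InnerProductSpace.rankOne ℂ (b k) (b k)).toLinearMap) =
      ∑ k, c k • pureRDM (b k : EuclideanSpace ℂ (Fin N → Fin d)) := by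
  ext p q
  simp only [oneRDM, Matrix.of_apply, kernel_sum, kernel_smul, kernel_rankOne, Matrix.sum_apply,
    Matrix.smul_apply, pureRDM, smul_eq_mul]
  rw [Finset.sum_comm, Finset.mul_sum]
  refine Finset.sum_congr rfl fun k _ => ?_
  rw [← Finset.mul_sum]
  ring

theorem eq_sum_smul_rankOne {E : Type*} [NormedAddCommGroup E] [InnerProductSpace ℂ E]
    {ι : Type*} [Fintype ι] (b : OrthonormalBasis ι ℂ E) {T : E →ₗ[ℂ] E} {c : ι → ℂ}
    (h : ∀ k, T (b k) = c k • b k) :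
    T = ∑ k, c k • (InnerProductSpace.rankOne ℂ (b k) (b k)).toLinearMap := by
  classical
  refine b.toBasis.ext fun k => ?_
  simp [h, LinearMap.sum_apply, orthonormal_iff_ite.mp b.orthonormal]

end

/-! ### Mixtures of orthonormal states -/

theorem map_eq_of_prod_X_sub_C_eq {n : ℕ} {f g : Fin n → ℝ}
    (h : ∏ i, (Polynomial.X - Polynomial.C (f i : ℂ)) =
      ∏ i, (Polynomial.X - Polynomial.C (g i : ℂ))) :
    Finset.univ.val.map f = Finset.univ.val.map g := by
  have hroots : ∀ f : Fin n → ℝ, (∏ i, (Polynomial.X - Polynomial.C (f i : ℂ))).roots =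
      Finset.univ.val.map fun i => (f i : ℂ) := by
    intro f
    rw [Polynomial.roots_prod]
    · simp
    · simp [Finset.prod_ne_zero_iff, Polynomial.X_sub_C_ne_zero]
  have h' := congrArg (fun p => (Polynomial.roots p).map Complex.re) h
  simpa only [hroots, Multiset.map_map, Function.comp_def, Complex.ofReal_re] using h'

/-- The characteristic polynomial fixes the multiset of eigenvalues, and two decreasing lists of one
multiset coincide. -/
theorem hasSpectrum_of_orthonormalBasis {E : Type*} [NormedAddCommGroup E]
    [InnerProductSpace ℂ E] [FiniteDimensional ℂ E] {T : E →ₗ[ℂ] E} (hT : T.IsSymmetric)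
    (b : OrthonormalBasis (Fin (Module.finrank ℂ E)) ℂ E) {w : ℕ → ℝ}
    (hw : Antitone w) (h : ∀ k, T (b k) = (w k : ℂ) • b k) : HasSpectrum T w := by
  refine ⟨hT, fun i => ?_⟩
  have hdiag : LinearMap.toMatrix b.toBasis b.toBasis T =
      Matrix.diagonal fun k : Fin (Module.finrank ℂ E) => (w k : ℂ) := by
    ext i j
    rw [LinearMap.toMatrix_apply, OrthonormalBasis.coe_toBasis, h,
      OrthonormalBasis.coe_toBasis_repr_apply, OrthonormalBasis.repr_apply_apply, inner_smul_right,
      orthonormal_iff_ite.mp b.orthonormal, Matrix.diagonal_apply]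
    split_ifs with hij
    · rw [hij, mul_one]
    · rw [mul_zero]
  have hchar : T.charpoly =
      ∏ k : Fin (Module.finrank ℂ E), (Polynomial.X - Polynomial.C (w k : ℂ)) := by
    rw [← T.charpoly_toMatrix b.toBasis, hdiag, Matrix.charpoly_diagonal]
  rw [hT.charpoly_eq rfl] at hchar
  exact congrFun (eq_of_antitone_of_map_eq (hT.eigenvalues_antitone rfl)
    (fun a b hab => hw hab) (map_eq_of_prod_X_sub_C_eq (g := fun k => w k) hchar)) i

theorem antitone_weights {w₁ w₂ w₃ : ℝ} (h₁₂ : w₂ ≤ w₁) (h₂₃ : w₃ ≤ w₂) (h₃ : 0 ≤ w₃) :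
    Antitone (weights w₁ w₂ w₃) := by
  refine antitone_nat_of_succ_le fun n => ?_
  rcases n with _ | _ | _ | n
  · exact h₁₂
  · exact h₂₃
  · exact h₃
  · exact le_rfl

theorem mixture_mem_densityOperators {E : Type*} [NormedAddCommGroup E] [InnerProductSpace ℂ E]
    [FiniteDimensional ℂ E] {w₁ w₂ w₃ : ℝ} (h₁₂ : w₂ ≤ w₁) (h₂₃ : w₃ ≤ w₂) (h₃ : 0 ≤ w₃)
    (hsum : w₁ + w₂ + w₃ = 1) {s : Fin 3 → E} (hs : Orthonormal ℂ s) :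
    ∑ k : Fin 3, (weights w₁ w₂ w₃ k : ℂ) • (InnerProductSpace.rankOne ℂ (s k) (s k)).toLinearMap
      ∈ densityOperators E (weights w₁ w₂ w₃) := by
  set T := ∑ k : Fin 3, (weights w₁ w₂ w₃ k : ℂ) •
    (InnerProductSpace.rankOne ℂ (s k) (s k)).toLinearMap with hT
  have hTv : ∀ v, T v = ∑ k : Fin 3, (weights w₁ w₂ w₃ k : ℂ) • inner ℂ (s k) v • s k := by
    intro v
    simp [hT, LinearMap.sum_apply]
  have hpos : T.IsPositive := by
    refine LinearMap.isPositive_sum _ fun k _ => LinearMap.IsPositive.smul_of_nonneg ?_ ?_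
    · exact (ContinuousLinearMap.isPositive_toLinearMap_iff _).mpr
        (InnerProductSpace.isPositive_rankOne_self (s k))
    · rw [Complex.zero_le_real]
      fin_cases k
      · exact h₃.trans (h₂₃.trans h₁₂)
      · exact h₃.trans h₂₃
      · exact h₃
  refine ⟨hpos, ?_, ?_⟩
  · rw [hT, map_sum]
    simp only [map_smul, InnerProductSpace.trace_rankOne, orthonormal_iff_ite.mp hs, if_true,
      smul_eq_mul, mul_one]
    rw [Fin.sum_univ_three]
    simp only [weights, Fin.val_zero, Fin.val_one, Fin.val_two]
    exact_mod_cast hsum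
  · have hcard : 3 ≤ Module.finrank ℂ E := by
      simpa using hs.linearIndependent.fintype_card_le_finrank
    let v : Fin (Module.finrank ℂ E) → E := fun k => if h : (k : ℕ) < 3 then s ⟨k, h⟩ else 0
    have hv : Orthonormal ℂ
        (Set.domRestrict {k : Fin (Module.finrank ℂ E) | (k : ℕ) < 3} v) := by
      have : Set.domRestrict {k : Fin (Module.finrank ℂ E) | (k : ℕ) < 3} v =
          s ∘ fun k => ⟨k.1, k.2⟩ := by
        ext k
        have hk : (k.1 : ℕ) < 3 := k.2
        simp [v, hk]
      rw [this]
      refine hs.comp _ fun a b hab => ?_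
      exact Subtype.ext (Fin.ext (Fin.mk.inj_iff.mp hab))
    obtain ⟨b, hb⟩ := hv.exists_orthonormalBasis_extension_of_card_eq (by simp)
    have hb' : ∀ j : Fin 3, s j = b ⟨j, by omega⟩ := by
      intro j
      rw [hb _ (show (_ : ℕ) < 3 from j.2)]
      simp [v]
    refine hasSpectrum_of_orthonormalBasis hpos.isSymmetric b (antitone_weights h₁₂ h₂₃ h₃)
      fun k => ?_
    rw [hTv]
    simp only [hb', orthonormal_iff_ite.mp b.orthonormal]
    rcases Nat.lt_or_ge k 3 with hk | hk
    · rw [Finset.sum_eq_single ⟨k, hk⟩]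
      · simp
      · intro j _ hj
        rw [if_neg, zero_smul, smul_zero]
        intro h
        exact hj (Fin.ext (by simp [← h]))
      · simp
    · rw [Finset.sum_eq_zero]
      · have : weights w₁ w₂ w₃ k = 0 := by
          obtain ⟨e, he⟩ := Nat.exists_eq_add_of_le' hk
          rw [he]
          rfl
        rw [this]
        simp
      · intro j _
        rw [if_neg, zero_smul, smul_zero]
        intro h
        have := congrArg Fin.val h
        simp only at this
        omega

section
variable {N d : ℕ} {w₁ w₂ w₃ : ℝ}

theorem configMixture_eq_sum (i₁ i₂ i₃ : Config N d) : configMixture w₁ w₂ w₃ i₁ i₂ i₃ =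
    ∑ k : Fin 3, (weights w₁ w₂ w₃ k : ℂ) • (InnerProductSpace.rankOne ℂ
      (slater (![i₁, i₂, i₃] k)) (slater (![i₁, i₂, i₃] k))).toLinearMap := by
  rw [Fin.sum_univ_three]
  rfl

theorem configMixture_mem_ensemble (h₁₂ : w₂ ≤ w₁) (h₂₃ : w₃ ≤ w₂) (h₃ : 0 ≤ w₃)
    (hsum : w₁ + w₂ + w₃ = 1) {i₁ i₂ i₃ : Config N d} (hne₁₂ : i₁ ≠ i₂) (hne₁₃ : i₁ ≠ i₃)
    (hne₂₃ : i₂ ≠ i₃) :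
    configMixture w₁ w₂ w₃ i₁ i₂ i₃ ∈ ensemble N d (weights w₁ w₂ w₃) := by
  rw [configMixture_eq_sum]
  refine mixture_mem_densityOperators h₁₂ h₂₃ h₃ hsum
    (orthonormal_slater.comp (![i₁, i₂, i₃]) fun a b hab => ?_)
  fin_cases a <;> fin_cases b <;> simp_all

/-- The occupation numbers of a mixture of three configurations. -/
def mixtureOccupation (w₁ w₂ w₃ : ℝ) (i₁ i₂ i₃ : Config N d) (a : Fin d) : ℝ :=
  w₁ * energy (Pi.single a 1) i₁ + w₂ * energy (Pi.single a 1) i₂ + w₃ * energy (Pi.single a 1) i₃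

theorem oneRDM_configMixture [NeZero N] (i₁ i₂ i₃ : Config N d) :
    oneRDM (configMixture w₁ w₂ w₃ i₁ i₂ i₃) =
      Matrix.diagonal fun a => (mixtureOccupation w₁ w₂ w₃ i₁ i₂ i₃ a : ℂ) := by
  rw [configMixture_eq_sum, oneRDM_sum_rankOne, Fin.sum_univ_three]
  simp only [pureRDM_slater]
  ext a b
  rcases eq_or_ne a b with rfl | h
  · simp [mixtureOccupation, weights]
  · simp [Matrix.diagonal_apply_ne _ h]

theorem sum_mul_energy_single (h : Fin d → ℝ) (i : Config N d) :
    ∑ a, h a * energy (Pi.single a 1) i = energy h i := by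
  simp only [energy, Finset.mul_sum, Pi.single_apply]
  rw [Finset.sum_comm]
  simp

theorem sum_mul_mixtureOccupation (h : Fin d → ℝ) (i₁ i₂ i₃ : Config N d) :
    ∑ a, h a * mixtureOccupation w₁ w₂ w₃ i₁ i₂ i₃ a =
      w₁ * energy h i₁ + w₂ * energy h i₂ + w₃ * energy h i₃ := by
  simp only [← sum_mul_energy_single h, Finset.mul_sum, ← Finset.sum_add_distrib]
  refine Finset.sum_congr rfl fun a _ => ?_
  rw [mixtureOccupation]
  ring

open Classical in
theorem energy_single (a : Fin d) (i : Config N d) :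
    energy (Pi.single a 1) i = if ∃ j, i j = a then 1 else 0 := by
  simp only [energy, Pi.single_apply]
  split_ifs with h
  · obtain ⟨j, rfl⟩ := h
    simp
  · exact Finset.sum_eq_zero fun j _ => if_neg fun hj => h ⟨j, hj⟩

/-! ### The variational principle for weighted sums -/

/-- An abstract Ky Fan type inequality for a matrix with row sums one and column sums at most one.
Only the lowest two columns need individual bounds; all other energies are replaced by `E i₃`. -/
theorem weighted_sum_energy_ge {ι : Type*} [Fintype ι] {n : ℕ} (hn : 3 ≤ n) (h₁₂ : w₂ ≤ w₁)
    (h₂₃ : w₃ ≤ w₂) (h₃ : 0 ≤ w₃) (p : Fin n → ι → ℝ) (hp : ∀ k i, 0 ≤ p k i)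
    (hrow : ∀ k, ∑ i, p k i = 1) (hcol : ∀ i, ∑ k, p k i ≤ 1) (E : ι → ℝ) {i₁ i₂ i₃ : ι}
    (hne : i₁ ≠ i₂) (e₁₂ : E i₁ ≤ E i₂) (e₂₃ : E i₂ ≤ E i₃)
    (hlow : ∀ i, i ≠ i₁ → i ≠ i₂ → E i₃ ≤ E i) :
    w₁ * E i₁ + w₂ * E i₂ + w₃ * E i₃ ≤
      ∑ k : Fin n, weights w₁ w₂ w₃ k * ∑ i, p k i * E i := by
  classical
  set w := weights w₁ w₂ w₃ with hw
  have hanti : Antitone w := antitone_weights h₁₂ h₂₃ h₃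
  have hwnn : ∀ k : ℕ, 0 ≤ w k := by
    intro k
    rcases k with _ | _ | _ | k
    · exact h₃.trans (h₂₃.trans h₁₂)
    · exact h₃.trans h₂₃
    · exact h₃
    · exact le_rfl
  have hwsum : ∑ k : Fin n, w k = w₁ + w₂ + w₃ := by
    obtain ⟨e, rfl⟩ := Nat.exists_eq_add_of_le hn
    rw [Fin.sum_univ_eq_sum_range w, Finset.sum_range_add, Finset.sum_eq_zero (s := Finset.range e),
      add_zero]
    · simp [Finset.sum_range_succ, hw, weights]
    · intro k _
      rw [add_comm]
      rfl
  have hrowE : ∀ k, E i₃ - p k i₁ * (E i₃ - E i₁) - p k i₂ * (E i₃ - E i₂)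
      ≤ ∑ i, p k i * E i := by
    intro k
    have h1 : ∑ i, ((if i = i₁ then p k i₁ * (E i₁ - E i₃) else 0)
        + (if i = i₂ then p k i₂ * (E i₂ - E i₃) else 0)) ≤ ∑ i, p k i * (E i - E i₃) := by
      refine Finset.sum_le_sum fun i _ => ?_
      by_cases hi1 : i = i₁
      · subst hi1
        simp [hne]
      by_cases hi2 : i = i₂
      · subst hi2
        simp [hi1]
      simp only [hi1, hi2, if_false, add_zero]
      exact mul_nonneg (hp k i) (sub_nonneg.mpr (hlow i hi1 hi2))
    simp only [Finset.sum_add_distrib, Finset.sum_ite_eq', Finset.mem_univ, if_true, mul_sub,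
      Finset.sum_sub_distrib, ← Finset.sum_mul, hrow] at h1
    linarith
  have hA₁ : ∑ k : Fin n, w k * p k i₁ ≤ w₁ := by
    calc ∑ k : Fin n, w k * p k i₁ ≤ ∑ k : Fin n, w₁ * p k i₁ :=
          Finset.sum_le_sum fun k _ => mul_le_mul_of_nonneg_right
            (show w k ≤ w 0 from hanti (Nat.zero_le _)) (hp _ _)
      _ = w₁ * ∑ k : Fin n, p k i₁ := by rw [Finset.mul_sum]
      _ ≤ w₁ * 1 := mul_le_mul_of_nonneg_left (hcol _) (hwnn 0)
      _ = w₁ := mul_one _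
  have hA₁₂ : ∑ k : Fin n, w k * (p k i₁ + p k i₂) ≤ w₁ + w₂ := by
    have hr : ∀ k, p k i₁ + p k i₂ ≤ 1 := by
      intro k
      rw [← hrow k, ← Finset.sum_pair hne]
      exact Finset.sum_le_sum_of_subset_of_nonneg (Finset.subset_univ _) fun i _ _ => hp k i
    -- Every weight is treated as `w₂`, with surplus `w₁ - w₂` in row zero only. The surplus is
    -- controlled by that row and the rest by the two columns, for a total of `w₁ - w₂ + 2 w₂`.
    have hterm : ∀ k : Fin n, w k * (p k i₁ + p k i₂) ≤
        w₂ * (p k i₁ + p k i₂) + if k = ⟨0, by omega⟩ then w₁ - w₂ else 0 := by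
      intro k
      split_ifs with hk
      · subst hk
        have := mul_le_mul_of_nonneg_left (hr ⟨0, by omega⟩) (sub_nonneg.mpr h₁₂)
        simp only [hw, weights]
        linarith
      · have hk' : 1 ≤ (k : ℕ) := by
          by_contra hc
          exact hk (Fin.ext (by simp only; omega))
        rw [add_zero]
        exact mul_le_mul_of_nonneg_right (show w k ≤ w 1 from hanti hk')
          (add_nonneg (hp _ _) (hp _ _))
    refine (Finset.sum_le_sum fun k _ => hterm k).trans ?_
    rw [Finset.sum_add_distrib, ← Finset.mul_sum, Finset.sum_add_distrib, Finset.sum_ite_eq',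
      if_pos (Finset.mem_univ _)]
    have h2 : (0 : ℝ) ≤ w₂ := hwnn 1
    nlinarith [hcol i₁, hcol i₂]
  have hmain : ∑ k : Fin n, w k * (E i₃ - p k i₁ * (E i₃ - E i₁) - p k i₂ * (E i₃ - E i₂))
      ≤ ∑ k : Fin n, w k * ∑ i, p k i * E i :=
    Finset.sum_le_sum fun k _ => mul_le_mul_of_nonneg_left (hrowE k) (hwnn k)
  refine le_trans ?_ hmain
  -- Summation by parts in the energies: the gaps `E i₂ - E i₁` and `E i₃ - E i₂` are nonnegative
  -- and multiply exactly the quantities bounded in `hA₁` and `hA₁₂`.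
  have hexp : ∑ k : Fin n, w k * (E i₃ - p k i₁ * (E i₃ - E i₁) - p k i₂ * (E i₃ - E i₂))
      = (∑ k : Fin n, w k) * E i₃ - (E i₂ - E i₁) * ∑ k : Fin n, w k * p k i₁
        - (E i₃ - E i₂) * ∑ k : Fin n, w k * (p k i₁ + p k i₂) := by
    rw [Finset.sum_mul, Finset.mul_sum, Finset.mul_sum, ← Finset.sum_sub_distrib,
      ← Finset.sum_sub_distrib]
    exact Finset.sum_congr rfl fun k _ => by ring
  rw [hexp, hwsum]
  have h1 := mul_le_mul_of_nonneg_left hA₁ (sub_nonneg.mpr e₁₂)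
  have h2 := mul_le_mul_of_nonneg_left hA₁₂ (sub_nonneg.mpr e₂₃)
  linarith

/-- Parseval over the Slater determinants gives the row sums, and Bessel's inequality for `φ` gives
the column bound. -/
theorem weighted_sum_pureRDM_ge [NeZero N] (h₁₂ : w₂ ≤ w₁) (h₂₃ : w₃ ≤ w₂) (h₃ : 0 ≤ w₃)
    {n : ℕ} (hn : 3 ≤ n) {φ : Fin n → fermionSpace N d} (hφ : Orthonormal ℂ φ) {h : Fin d → ℝ}
    {i₁ i₂ i₃ : Config N d} (hi : IsLowestThree h i₁ i₂ i₃) :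
    w₁ * energy h i₁ + w₂ * energy h i₂ + w₃ * energy h i₃ ≤ ∑ k : Fin n, weights w₁ w₂ w₃ k *
      ∑ a, h a * (pureRDM (φ k : EuclideanSpace ℂ (Fin N → Fin d)) a a).re := by
  obtain ⟨h1, -, -, e12, e23, hlow⟩ := hi
  simp only [sum_mul_pureRDM_diag]
  refine weighted_sum_energy_ge hn h₁₂ h₂₃ h₃ (fun k i => ‖inner ℂ (slater i) (φ k)‖ ^ 2)
    (fun _ _ => sq_nonneg _) (fun k => ?_) (fun i => ?_) (energy h) h1 e12 e23 fun i ha hb => ?_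
  · rw [sum_norm_inner_slater_sq, hφ.1 k, one_pow]
  · have := hφ.sum_inner_products_le (slater i) (s := Finset.univ)
    rw [orthonormal_slater.1 i, one_pow] at this
    refine le_trans (le_of_eq (Finset.sum_congr rfl fun k _ => ?_)) this
    rw [norm_inner_symm]
  · by_cases hc : i = i₃
    · rw [hc]
    · exact hlow i ha hb hc

end

/-! ### Change of the one-particle basis -/

section
variable {N d : ℕ}

/-- The `N`-fold tensor power of a matrix. -/
def tensorPower (N : ℕ) (A : Matrix (Fin d) (Fin d) ℂ) :
    Matrix (Fin N → Fin d) (Fin N → Fin d) ℂ :=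
  Matrix.of fun x y => ∏ j, A (x j) (y j)

theorem conjTranspose_tensorPower_mul_self {A : Matrix (Fin d) (Fin d) ℂ} (hA : Aᴴ * A = 1) :
    (tensorPower N A)ᴴ * tensorPower N A = 1 := by
  ext x y
  simp only [Matrix.mul_apply, Matrix.conjTranspose_apply, tensorPower, Matrix.of_apply,
    star_prod, ← Finset.prod_mul_distrib]
  have h := Finset.prod_univ_sum (fun _ : Fin N => (Finset.univ : Finset (Fin d)))
    (fun j z => star (A z (x j)) * A z (y j))
  rw [Fintype.piFinset_univ] at h
  rw [← h]
  have h' : ∀ j, ∑ z, star (A z (x j)) * A z (y j) = (1 : Matrix (Fin d) (Fin d) ℂ) (x j) (y j) := by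
    intro j
    rw [← hA]
    simp [Matrix.mul_apply]
  simp only [h', Matrix.one_apply]
  rw [Finset.prod_ite_zero]
  simp [funext_iff]

theorem star_mulVec_dotProduct_mulVec {ι : Type*} [Fintype ι] [DecidableEq ι] {M : Matrix ι ι ℂ}
    (hM : Mᴴ * M = 1) (u v : ι → ℂ) : M *ᵥ u ⬝ᵥ star (M *ᵥ v) = u ⬝ᵥ star v := by
  rw [Matrix.star_mulVec, dotProduct_comm, ← Matrix.dotProduct_mulVec, Matrix.mulVec_mulVec, hM,
    Matrix.one_mulVec, dotProduct_comm]

/-- The action of a one-particle matrix on the `N`-fermion space. -/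
def rotate (A : Matrix (Fin d) (Fin d) ℂ) (ψ : fermionSpace N d) : fermionSpace N d :=
  ⟨WithLp.toLp 2 (tensorPower N A *ᵥ (ψ : EuclideanSpace ℂ (Fin N → Fin d))), by
    intro σ x
    simp only [Matrix.mulVec, dotProduct, tensorPower, Matrix.of_apply]
    rw [← Equiv.sum_comp (σ.symm.arrowCongr (Equiv.refl (Fin d))), Finset.mul_sum]
    refine Finset.sum_congr rfl fun y _ => ?_
    have hy : σ.symm.arrowCongr (Equiv.refl (Fin d)) y = y ∘ σ := by
      ext; simp
    rw [hy, apply_comp_perm]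
    simp only [Function.comp_apply]
    rw [Equiv.prod_comp σ fun j => A (x j) (y j)]
    ring⟩

theorem inner_rotate {A : Matrix (Fin d) (Fin d) ℂ} (hA : Aᴴ * A = 1) (ψ φ : fermionSpace N d) :
    inner ℂ (rotate A ψ) (rotate A φ) = inner ℂ ψ φ := by
  rw [Submodule.coe_inner, Submodule.coe_inner, EuclideanSpace.inner_eq_star_dotProduct,
    EuclideanSpace.inner_eq_star_dotProduct]
  exact star_mulVec_dotProduct_mulVec (conjTranspose_tensorPower_mul_self hA) _ _

theorem sum_filter_zero_eq {n : ℕ} {M : Type*} [AddCommMonoid M] (a : Fin d)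
    (F : (Fin (n + 1) → Fin d) → M) :
    ∑ x : Fin (n + 1) → Fin d with x 0 = a, F x = ∑ y : Fin n → Fin d, F (Fin.cons a y) := by
  rw [Finset.sum_filter, ← (Fin.consEquiv fun _ : Fin (n + 1) => Fin d).sum_comp,
    Fintype.sum_prod_type]
  simp [Fin.consEquiv]

theorem pureRDM_succ_apply {n : ℕ} (ψ : EuclideanSpace ℂ (Fin (n + 1) → Fin d)) (a b : Fin d) :
    pureRDM ψ a b = ((n + 1 : ℕ) : ℂ) * ∑ y : Fin n → Fin d,
      ψ (Fin.cons a y : Fin (n + 1) → Fin d) *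
        starRingEnd ℂ (ψ (Fin.cons b y : Fin (n + 1) → Fin d)) := by
  simp only [pureRDM, Matrix.of_apply]
  rw [sum_filter_zero_eq a (fun x => ψ x * starRingEnd ℂ (ψ (Function.update x 0 b)))]
  simp

/-- Splitting off the first particle, the tensor power on the remaining `n` is an isometry and drops
out of the partial trace; only the action on the first particle remains. -/
theorem pureRDM_rotate {n : ℕ} {A : Matrix (Fin d) (Fin d) ℂ} (hA : Aᴴ * A = 1)
    (ψ : fermionSpace (n + 1) d) :
    pureRDM (rotate A ψ : EuclideanSpace ℂ (Fin (n + 1) → Fin d)) =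
      A * pureRDM (ψ : EuclideanSpace ℂ (Fin (n + 1) → Fin d)) * Aᴴ := by
  ext a b
  let φ : Fin d → (Fin n → Fin d) → ℂ := fun a y => ∑ c, A a c *
    (ψ : EuclideanSpace ℂ (Fin (n + 1) → Fin d)) (Fin.cons c y : Fin (n + 1) → Fin d)
  have hφ : ∀ a x, (rotate A ψ : EuclideanSpace ℂ (Fin (n + 1) → Fin d))
      (Fin.cons a x : Fin (n + 1) → Fin d) = (tensorPower n A *ᵥ φ a) x := by
    intro a x
    change (tensorPower (n + 1) A *ᵥ (ψ : EuclideanSpace ℂ (Fin (n + 1) → Fin d)))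
      (Fin.cons a x : Fin (n + 1) → Fin d) = _
    simp only [Matrix.mulVec, dotProduct, tensorPower, Matrix.of_apply, φ]
    rw [← (Fin.consEquiv fun _ : Fin (n + 1) => Fin d).sum_comp, Fintype.sum_prod_type,
      Finset.sum_comm]
    refine Finset.sum_congr rfl fun y _ => ?_
    rw [Finset.mul_sum]
    refine Finset.sum_congr rfl fun c _ => ?_
    simp only [Fin.consEquiv, Equiv.coe_fn_mk, Fin.prod_univ_succ, Fin.cons_zero, Fin.cons_succ]
    ring
  rw [pureRDM_succ_apply]
  simp only [hφ]
  have h := star_mulVec_dotProduct_mulVec (conjTranspose_tensorPower_mul_self (N := n) hA)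
    (φ a) (φ b)
  simp only [dotProduct, Pi.star_apply] at h
  simp only [starRingEnd_apply]
  rw [h]
  simp only [Matrix.mul_apply, Matrix.conjTranspose_apply, pureRDM_succ_apply, φ, star_sum,
    star_mul', Finset.mul_sum, Finset.sum_mul, starRingEnd_apply]
  rw [Finset.sum_comm]
  refine Finset.sum_congr rfl fun c _ => ?_
  rw [Finset.sum_comm]
  refine Finset.sum_congr rfl fun c' _ => Finset.sum_congr rfl fun y _ => ?_
  ring

/-! ### The energy bound on relaxed reduced density matrices -/

variable {m : ℕ} {w₁ w₂ w₃ : ℝ}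

theorem three_le_finrank_of_isLowestThree {h : Fin d → ℝ} {i₁ i₂ i₃ : Config N d}
    (hi : IsLowestThree h i₁ i₂ i₃) : 3 ≤ Module.finrank ℂ (fermionSpace N d) := by
  have hs : Orthonormal ℂ (slater ∘ ![i₁, i₂, i₃] : Fin 3 → fermionSpace N d) := by
    refine orthonormal_slater.comp _ fun a b hab => ?_
    obtain ⟨h1, h2, h3, -⟩ := hi
    fin_cases a <;> fin_cases b <;> simp_all
  simpa using hs.linearIndependent.fintype_card_le_finrank

theorem oneRDM_eq_sum_of_mem_ensemble [NeZero N] {w : ℕ → ℝ} {Γ : FermionOp N d}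
    (hΓ : Γ ∈ ensemble N d w) :
    ∃ φ : Fin (Module.finrank ℂ (fermionSpace N d)) → fermionSpace N d, Orthonormal ℂ φ ∧
      oneRDM Γ = ∑ k : Fin _, (w k : ℂ) • pureRDM (φ k : EuclideanSpace ℂ (Fin N → Fin d)) := by
  obtain ⟨-, -, hT, hw⟩ := hΓ
  refine ⟨hT.eigenvectorBasis rfl, (hT.eigenvectorBasis rfl).orthonormal, ?_⟩
  conv_lhs => rw [eq_sum_smul_rankOne (hT.eigenvectorBasis rfl)
    (c := fun k => (hT.eigenvalues rfl k : ℂ)) (hT.apply_eigenvectorBasis rfl)]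
  rw [oneRDM_sum_rankOne]
  simp only [hw]

theorem orthonormal_rotate {A : Matrix (Fin d) (Fin d) ℂ} (hA : Aᴴ * A = 1) {ι : Type*}
    {φ : ι → fermionSpace N d} (hφ : Orthonormal ℂ φ) :
    Orthonormal ℂ fun k => rotate A (φ k) := by
  classical
  rw [orthonormal_iff_ite] at hφ ⊢
  simpa only [inner_rotate hA] using hφ

theorem isLinearMap_sum_mul_re_conj (A : Matrix (Fin d) (Fin d) ℂ) (h : Fin d → ℝ) :
    IsLinearMap ℝ fun γ : Matrix (Fin d) (Fin d) ℂ => ∑ a, h a * ((A * γ * Aᴴ) a a).re := by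
  constructor
  · intro x y
    simp [Matrix.add_mul, mul_add, Finset.sum_add_distrib]
  · intro c x
    simp only [Matrix.mul_smul, Matrix.smul_mul, Matrix.smul_apply, Complex.smul_re, smul_eq_mul,
      Finset.mul_sum]
    exact Finset.sum_congr rfl fun _ _ => by ring

/-- The bound is a closed halfspace in `γ`, so checking it on the ensemble suffices. Conjugation by
`A` is absorbed by rotating the eigenvectors, which stay orthonormal. -/
theorem relaxedOneRDM_energy_ge {n : ℕ} (h₁₂ : w₂ ≤ w₁) (h₂₃ : w₃ ≤ w₂) (h₃ : 0 ≤ w₃)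
    {A : Matrix (Fin d) (Fin d) ℂ} (hA : Aᴴ * A = 1) {h : Fin d → ℝ}
    {i₁ i₂ i₃ : Config (n + 1) d} (hi : IsLowestThree h i₁ i₂ i₃)
    {γ : Matrix (Fin d) (Fin d) ℂ} (hγ : γ ∈ relaxedOneRDM (n + 1) d (weights w₁ w₂ w₃)) :
    w₁ * energy h i₁ + w₂ * energy h i₂ + w₃ * energy h i₃ ≤
      ∑ a, h a * ((A * γ * Aᴴ) a a).re := by
  refine convexHull_min (t := {γ : Matrix (Fin d) (Fin d) ℂ |
    w₁ * energy h i₁ + w₂ * energy h i₂ + w₃ * energy h i₃ ≤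
      ∑ a, h a * ((A * γ * Aᴴ) a a).re}) ?_ ?_ hγ
  · rintro _ ⟨Γ, hΓ, rfl⟩
    obtain ⟨φ, hφ, hΓφ⟩ := oneRDM_eq_sum_of_mem_ensemble hΓ
    have hbound := weighted_sum_pureRDM_ge h₁₂ h₂₃ h₃ (three_le_finrank_of_isLowestThree hi)
      (orthonormal_rotate hA hφ) hi
    refine hbound.trans (le_of_eq ?_)
    simp only [pureRDM_rotate hA, hΓφ, Matrix.sum_mul, Matrix.mul_smul,
      Matrix.smul_mul, Matrix.sum_apply, Matrix.smul_apply, smul_eq_mul, Complex.re_sum,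
      Complex.re_ofReal_mul, Finset.mul_sum]
    rw [Finset.sum_comm]
    refine Finset.sum_congr rfl fun _ _ => Finset.sum_congr rfl fun _ _ => ?_
    ring
  · exact convex_halfSpace_ge (isLinearMap_sum_mul_re_conj A h) _

theorem oneBodyEnergy_eq_sum (h : Fin d → ℝ) (γ : Matrix (Fin d) (Fin d) ℂ) :
    oneBodyEnergy h γ = ∑ a, h a * (γ a a).re := by
  simp [oneBodyEnergy, Matrix.trace, Matrix.diagonal_mul]

theorem oneBodyEnergy_configMixture [NeZero N] (h : Fin d → ℝ) (i₁ i₂ i₃ : Config N d) :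
    oneBodyEnergy h (oneRDM (configMixture w₁ w₂ w₃ i₁ i₂ i₃)) =
      w₁ * energy h i₁ + w₂ * energy h i₂ + w₃ * energy h i₃ := by
  rw [oneBodyEnergy_eq_sum, oneRDM_configMixture]
  simp only [Matrix.diagonal_apply_eq, Complex.ofReal_re]
  exact sum_mul_mixtureOccupation h i₁ i₂ i₃

theorem isMinOn_oneBodyEnergy {n : ℕ} (h₁₂ : w₂ ≤ w₁) (h₂₃ : w₃ ≤ w₂) (h₃ : 0 ≤ w₃)
    {h : Fin d → ℝ} {i₁ i₂ i₃ : Config (n + 1) d} (hi : IsLowestThree h i₁ i₂ i₃) :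
    IsMinOn (oneBodyEnergy h) (relaxedOneRDM (n + 1) d (weights w₁ w₂ w₃))
      (oneRDM (configMixture w₁ w₂ w₃ i₁ i₂ i₃)) := by
  intro γ hγ
  have := relaxedOneRDM_energy_ge h₁₂ h₂₃ h₃ (A := 1) (by simp) hi hγ
  simp only [Matrix.conjTranspose_one, Matrix.one_mul, Matrix.mul_one] at this
  simpa only [Set.mem_ofPred_eq, oneBodyEnergy_configMixture, oneBodyEnergy_eq_sum h γ] using this

/-! ### Occupation numbers of the lowest configurations -/

theorem exists_configGround_eq_iff (hd : m + 2 + 2 ≤ d) (a : Fin d) :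
    (∃ j : Fin (m + 2), configGround hd j = a) ↔ (a : ℕ) < m + 2 := by
  constructor
  · rintro ⟨j, rfl⟩
    exact j.2
  · intro h
    exact ⟨⟨a, h⟩, Fin.ext rfl⟩

theorem exists_configFirst_eq_iff (hd : m + 2 + 2 ≤ d) (a : Fin d) :
    (∃ j : Fin (m + 2), configFirst hd j = a) ↔ (a : ℕ) < m + 1 ∨ (a : ℕ) = m + 2 := by
  constructor
  · rintro ⟨j, rfl⟩
    rw [coe_configFirst]
    split_ifs <;> omega
  · rintro (h | h)
    · exact ⟨⟨a, by omega⟩, Fin.ext (by rw [coe_configFirst]; simp only; split_ifs <;> omega)⟩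
    · exact ⟨⟨m + 1, by omega⟩, Fin.ext (by rw [coe_configFirst]; simp only; split_ifs <;> omega)⟩

theorem exists_configA_eq_iff (hd : m + 2 + 2 ≤ d) (a : Fin d) :
    (∃ j : Fin (m + 2), configA hd j = a) ↔ (a : ℕ) < m + 1 ∨ (a : ℕ) = m + 3 := by
  constructor
  · rintro ⟨j, rfl⟩
    rw [coe_configA]
    split_ifs <;> omega
  · rintro (h | h)
    · exact ⟨⟨a, by omega⟩, Fin.ext (by rw [coe_configA]; simp only; split_ifs <;> omega)⟩
    · exact ⟨⟨m + 1, by omega⟩, Fin.ext (by rw [coe_configA]; simp only; split_ifs <;> omega)⟩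

theorem exists_configB_eq_iff (hd : m + 2 + 2 ≤ d) (a : Fin d) :
    (∃ j : Fin (m + 2), configB hd j = a) ↔
      (a : ℕ) < m ∨ (a : ℕ) = m + 1 ∨ (a : ℕ) = m + 2 := by
  constructor
  · rintro ⟨j, rfl⟩
    rw [coe_configB]
    split_ifs <;> omega
  · rintro (h | h | h)
    · exact ⟨⟨a, by omega⟩, Fin.ext (by rw [coe_configB]; simp only; split_ifs <;> omega)⟩
    · exact ⟨⟨m, by omega⟩, Fin.ext (by rw [coe_configB]; simp only; split_ifs <;> omega)⟩
    · exact ⟨⟨m + 1, by omega⟩, Fin.ext (by rw [coe_configB]; simp only; split_ifs <;> omega)⟩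

theorem mixtureOccupation_configA (hd : m + 2 + 2 ≤ d) (hsum : w₁ + w₂ + w₃ = 1) :
    mixtureOccupation w₁ w₂ w₃ (configGround hd : Config (m + 2) d) (configFirst hd) (configA hd)
      = vertex₁ (m + 2) d w₁ w₂ w₃ := by
  ext a
  simp only [mixtureOccupation, energy_single, exists_configGround_eq_iff,
    exists_configFirst_eq_iff, exists_configA_eq_iff, vertex₁]
  split_ifs <;> first | omega | linarith

theorem mixtureOccupation_configB (hd : m + 2 + 2 ≤ d) (hsum : w₁ + w₂ + w₃ = 1) :
    mixtureOccupation w₁ w₂ w₃ (configGround hd : Config (m + 2) d) (configFirst hd) (configB hd)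
      = vertex₂ (m + 2) d w₁ w₂ w₃ := by
  ext a
  simp only [mixtureOccupation, energy_single, exists_configGround_eq_iff,
    exists_configFirst_eq_iff, exists_configB_eq_iff, vertex₂]
  split_ifs <;> first | omega | linarith

/-- The configuration obtained from `i` by relabelling the orbitals with `σ`. -/
def relabel (σ : Equiv.Perm (Fin d)) (i : Config N d) : Config N d :=
  (Finset.univ.map (i.toEmbedding.trans σ.toEmbedding)).orderEmbOfFin (by simp)

theorem range_relabel (σ : Equiv.Perm (Fin d)) (i : Config N d) :
    Set.range (relabel σ i) = σ '' Set.range i := by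
  rw [relabel, Finset.range_orderEmbOfFin]
  ext a
  simp [Equiv.eq_symm_apply]

theorem relabel_injective (σ : Equiv.Perm (Fin d)) :
    Function.Injective (relabel σ : Config N d → Config N d) := by
  intro i k h
  have h' := congrArg (fun j : Config N d => Set.range j) h
  simp only [range_relabel] at h'
  have h'' := σ.injective.image_injective h'
  exact RelEmbedding.ext fun j =>
    congrFun ((StrictMono.range_inj i.strictMono k.strictMono).mp h'') j

theorem mixtureOccupation_relabel (σ : Equiv.Perm (Fin d)) (i₁ i₂ i₃ : Config N d) :
    mixtureOccupation w₁ w₂ w₃ (relabel σ.symm i₁) (relabel σ.symm i₂) (relabel σ.symm i₃) =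
      mixtureOccupation w₁ w₂ w₃ i₁ i₂ i₃ ∘ σ := by
  have h : ∀ (i : Config N d) (a : Fin d),
      (∃ j, relabel σ.symm i j = a) ↔ ∃ j, i j = σ a := by
    intro i a
    have := range_relabel σ.symm i
    rw [Set.ext_iff] at this
    refine (this a).trans ?_
    simp
  ext a
  simp only [mixtureOccupation, energy_single, h, Function.comp_apply]

theorem diagonal_mixtureOccupation_mem [NeZero N] (h₁₂ : w₂ ≤ w₁) (h₂₃ : w₃ ≤ w₂) (h₃ : 0 ≤ w₃)
    (hsum : w₁ + w₂ + w₃ = 1) {i₁ i₂ i₃ : Config N d} (hne₁₂ : i₁ ≠ i₂) (hne₁₃ : i₁ ≠ i₃)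
    (hne₂₃ : i₂ ≠ i₃) {l : Fin d → ℝ}
    (hl : l ∈ permutations (mixtureOccupation w₁ w₂ w₃ i₁ i₂ i₃)) :
    (Matrix.diagonal fun a => (l a : ℂ)) ∈ oneRDM '' ensemble N d (weights w₁ w₂ w₃) := by
  obtain ⟨σ, rfl⟩ := hl
  refine ⟨configMixture w₁ w₂ w₃ (relabel σ.symm i₁) (relabel σ.symm i₂) (relabel σ.symm i₃),
    configMixture_mem_ensemble h₁₂ h₂₃ h₃ hsum ((relabel_injective _).ne hne₁₂)
      ((relabel_injective _).ne hne₁₃) ((relabel_injective _).ne hne₂₃), ?_⟩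
  rw [oneRDM_configMixture, mixtureOccupation_relabel]

/-! ### The spectral polytope -/

theorem exists_perm_eq_eigenvalues_comp (l : Fin d → ℝ)
    (h : (Matrix.diagonal fun a => (l a : ℂ)).IsHermitian) :
    ∃ σ : Equiv.Perm (Fin d), l = h.eigenvalues ∘ σ := by
  refine exists_perm_eq_comp_of_map_eq (map_eq_of_prod_X_sub_C_eq ?_)
  have := h.charpoly_eq
  rw [Matrix.charpoly_diagonal] at this
  exact this

theorem convexHull_subset_spectralPolytope [NeZero N] {v₁ v₂ : Fin d → ℝ} {w : ℕ → ℝ}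
    (h : ∀ l ∈ permutations v₁ ∪ permutations v₂,
      (Matrix.diagonal fun a => (l a : ℂ)) ∈ oneRDM '' ensemble N d w) :
    convexHull ℝ (permutations v₁ ∪ permutations v₂) ⊆ spectralPolytope N d w := by
  let D : (Fin d → ℝ) →ₗ[ℝ] Matrix (Fin d) (Fin d) ℂ :=
    { toFun := fun l => Matrix.diagonal fun a => (l a : ℂ)
      map_add' := fun x y => by simp [Matrix.diagonal_add]
      map_smul' := fun c x => by
        ext a b
        rcases eq_or_ne a b with rfl | hab
        · simp
        · simp [Matrix.diagonal_apply_ne _ hab] }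
  intro l hl
  have hmem : D l ∈ relaxedOneRDM N d w := by
    have h1 := Set.mem_image_of_mem D hl
    rw [LinearMap.image_convexHull] at h1
    refine convexHull_mono ?_ h1
    rintro _ ⟨x, hx, rfl⟩
    exact h x hx
  have hherm : (D l).IsHermitian := by
    refine Matrix.isHermitian_diagonal_of_self_adjoint _ ?_
    ext a
    simp
  exact ⟨D l, hmem, hherm, exists_perm_eq_eigenvalues_comp l hherm⟩

/-- The matrix is the adjoint of the eigenvector unitary with its rows permuted by `ρ`. -/
theorem exists_conj_diag_eq {γ : Matrix (Fin d) (Fin d) ℂ} (hγ : γ.IsHermitian)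
    (ρ : Equiv.Perm (Fin d)) : ∃ A : Matrix (Fin d) (Fin d) ℂ, Aᴴ * A = 1 ∧
      ∀ a, ((A * γ * Aᴴ) a a).re = hγ.eigenvalues (ρ a) := by
  set U : Matrix (Fin d) (Fin d) ℂ := hγ.eigenvectorUnitary.1 with hU
  have hU1 : Uᴴ * U = 1 := Unitary.coe_star_mul_self hγ.eigenvectorUnitary
  have hU2 : U * Uᴴ = 1 := Unitary.coe_mul_star_self hγ.eigenvectorUnitary
  have hspec : γ = U * Matrix.diagonal (fun a => (hγ.eigenvalues a : ℂ)) * Uᴴ := by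
    conv_lhs => rw [hγ.spectral_theorem, Unitary.conjStarAlgAut_apply]
    rfl
  have hdiag : Uᴴ * γ * U = Matrix.diagonal (fun a => (hγ.eigenvalues a : ℂ)) := by
    generalize hγ.eigenvalues = e at hspec ⊢
    rw [hspec]
    calc Uᴴ * (U * Matrix.diagonal (fun a => (e a : ℂ)) * Uᴴ) * U
        = (Uᴴ * U) * Matrix.diagonal (fun a => (e a : ℂ)) * (Uᴴ * U) := by
          simp only [Matrix.mul_assoc]
      _ = _ := by rw [hU1, Matrix.one_mul, Matrix.mul_one]
  refine ⟨Uᴴ.submatrix ρ id, ?_, fun a => ?_⟩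
  · rw [Matrix.conjTranspose_submatrix, Matrix.conjTranspose_conjTranspose,
      Matrix.submatrix_mul_equiv, hU2, Matrix.submatrix_id_id]
  · have : Uᴴ.submatrix ρ id * γ * (Uᴴ.submatrix ρ id)ᴴ = (Uᴴ * γ * U).submatrix ρ ρ := by
      rw [Matrix.conjTranspose_submatrix, Matrix.conjTranspose_conjTranspose]
      rfl
    rw [this, hdiag]
    simp

theorem spectralPolytope_subset_convexHull (hd : m + 2 + 2 ≤ d) (h₁₂ : w₂ ≤ w₁) (h₂₃ : w₃ ≤ w₂)
    (h₃ : 0 ≤ w₃) (hsum : w₁ + w₂ + w₃ = 1) :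
    spectralPolytope (m + 2) d (weights w₁ w₂ w₃) ⊆
      convexHull ℝ (permutations (vertex₁ (m + 2) d w₁ w₂ w₃) ∪
        permutations (vertex₂ (m + 2) d w₁ w₂ w₃)) := by
  rintro l ⟨γ, hγ, hherm, σ, rfl⟩
  refine mem_convexHull_permutations fun c hc τ => ?_
  obtain ⟨A, hA, hdiag⟩ := exists_conj_diag_eq hherm (τ.trans σ)
  -- Maximizing against `c` means minimizing the energy with increasing levels `-c`.
  have hmono : Monotone (-c) := hc.neg
  have key : ∀ i₁ i₂ i₃ : Config (m + 2) d, IsLowestThree (-c) i₁ i₂ i₃ →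
      ∑ k, c k * (hherm.eigenvalues ∘ σ) (τ k) ≤
        ∑ k, c k * mixtureOccupation w₁ w₂ w₃ i₁ i₂ i₃ k := by
    intro i₁ i₂ i₃ hi
    have := relaxedOneRDM_energy_ge h₁₂ h₂₃ h₃ hA hi hγ
    rw [← sum_mul_mixtureOccupation] at this
    simp only [hdiag, Pi.neg_apply, neg_mul, Finset.sum_neg_distrib] at this
    exact neg_le_neg_iff.mp this
  rcases le_total (energy (-c) (configA hd : Config (m + 2) d)) (energy (-c) (configB hd))
    with h | h
  · have := key _ _ _ (isLowestThree_configA hd hmono h)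
    rw [mixtureOccupation_configA hd hsum] at this
    exact this.trans (le_max_left _ _)
  · have := key _ _ _ (isLowestThree_configB hd hmono h)
    rw [mixtureOccupation_configB hd hsum] at this
    exact this.trans (le_max_right _ _)

theorem spectralPolytope_eq_convexHull (hd : m + 2 + 2 ≤ d) (h₁₂ : w₂ ≤ w₁) (h₂₃ : w₃ ≤ w₂)
    (h₃ : 0 ≤ w₃) (hsum : w₁ + w₂ + w₃ = 1) :
    spectralPolytope (m + 2) d (weights w₁ w₂ w₃) =
      convexHull ℝ (permutations (vertex₁ (m + 2) d w₁ w₂ w₃) ∪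
        permutations (vertex₂ (m + 2) d w₁ w₂ w₃)) := by
  refine (spectralPolytope_subset_convexHull hd h₁₂ h₂₃ h₃ hsum).antisymm
    (convexHull_subset_spectralPolytope ?_)
  rintro l (hl | hl)
  · rw [← mixtureOccupation_configA hd hsum] at hl
    exact diagonal_mixtureOccupation_mem h₁₂ h₂₃ h₃ hsum (configGround_ne_configFirst hd)
      (configGround_ne_configA hd) (configFirst_ne_configA hd) hl
  · rw [← mixtureOccupation_configB hd hsum] at hl
    exact diagonal_mixtureOccupation_mem h₁₂ h₂₃ h₃ hsum (configGround_ne_configFirst hd)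
      (configGround_ne_configB hd) (configFirst_ne_configB hd) hl

end

end WRDMFT

end

/-! ### Assembly of the three representations. -/

theorem mainTheorem4 (N d : ℕ) [NeZero N] (hN : 2 ≤ N) (hd : N + 2 ≤ d) (w₁ w₂ w₃ : ℝ)
    (h₁₂ : w₂ ≤ w₁) (h₂₃ : w₃ ≤ w₂) (h₃ : 0 ≤ w₃) (hsum : w₁ + w₂ + w₃ = 1) :
    -- vertex representation
    (WRDMFT.spectralPolytope N d (WRDMFT.weights w₁ w₂ w₃) =
      convexHull ℝ (WRDMFT.permutations (WRDMFT.vertex₁ N d w₁ w₂ w₃) ∪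
        WRDMFT.permutations (WRDMFT.vertex₂ N d w₁ w₂ w₃))) ∧
    (Set.extremePoints ℝ (WRDMFT.spectralPolytope N d (WRDMFT.weights w₁ w₂ w₃)) =
      WRDMFT.permutations (WRDMFT.vertex₁ N d w₁ w₂ w₃) ∪
        WRDMFT.permutations (WRDMFT.vertex₂ N d w₁ w₂ w₃)) ∧
    (0 < w₃ → WRDMFT.vertex₂ N d w₁ w₂ w₃ ∉
      WRDMFT.permutations (WRDMFT.vertex₁ N d w₁ w₂ w₃)) ∧
    -- the possible orderings of the three lowest configurations
    (∀ h : Fin d → ℝ, Monotone h →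
      (WRDMFT.energy h (WRDMFT.configA hd) ≤ WRDMFT.energy h (WRDMFT.configB hd) →
        WRDMFT.IsLowestThree h (WRDMFT.configGround hd) (WRDMFT.configFirst hd)
          (WRDMFT.configA hd)) ∧
      (WRDMFT.energy h (WRDMFT.configB hd) ≤ WRDMFT.energy h (WRDMFT.configA hd) →
        WRDMFT.IsLowestThree h (WRDMFT.configGround hd) (WRDMFT.configFirst hd)
          (WRDMFT.configB hd))) ∧
    (∀ h : Fin d → ℝ, StrictMono h → ∀ i₁ i₂ i₃ : WRDMFT.Config N d,
      WRDMFT.IsLowestThree h i₁ i₂ i₃ →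
        i₁ = WRDMFT.configGround hd ∧ i₂ = WRDMFT.configFirst hd ∧
          (i₃ = WRDMFT.configA hd ∨ i₃ = WRDMFT.configB hd)) ∧
    (∃ h : Fin d → ℝ, StrictMono h ∧
      WRDMFT.energy h (WRDMFT.configA hd) < WRDMFT.energy h (WRDMFT.configB hd)) ∧
    (∃ h : Fin d → ℝ, StrictMono h ∧
      WRDMFT.energy h (WRDMFT.configB hd) < WRDMFT.energy h (WRDMFT.configA hd)) ∧
    -- the corresponding minimizers and their occupation numbers
    (∀ h : Fin d → ℝ, Monotone h → ∀ i₁ i₂ i₃ : WRDMFT.Config N d,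
      WRDMFT.IsLowestThree h i₁ i₂ i₃ →
        WRDMFT.configMixture w₁ w₂ w₃ i₁ i₂ i₃ ∈
            WRDMFT.ensemble N d (WRDMFT.weights w₁ w₂ w₃) ∧
          IsMinOn (WRDMFT.oneBodyEnergy h)
            (WRDMFT.relaxedOneRDM N d (WRDMFT.weights w₁ w₂ w₃))
            (WRDMFT.oneRDM (WRDMFT.configMixture w₁ w₂ w₃ i₁ i₂ i₃))) ∧
    (WRDMFT.oneRDM (WRDMFT.configMixture w₁ w₂ w₃ (WRDMFT.configGround hd)
        (WRDMFT.configFirst hd) (WRDMFT.configA hd)) =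
      Matrix.diagonal fun i => (WRDMFT.vertex₁ N d w₁ w₂ w₃ i : ℂ)) ∧
    (WRDMFT.oneRDM (WRDMFT.configMixture w₁ w₂ w₃ (WRDMFT.configGround hd)
        (WRDMFT.configFirst hd) (WRDMFT.configB hd)) =
      Matrix.diagonal fun i => (WRDMFT.vertex₂ N d w₁ w₂ w₃ i : ℂ)) ∧
    -- halfspace representation, with one new constraint
    (∀ l : Fin d → ℝ, l ∈ WRDMFT.spectralPolytope N d (WRDMFT.weights w₁ w₂ w₃) ↔
      WRDMFT.LevelTwoConstraints N w₁ l ∧ WRDMFT.LevelThreeConstraint N w₁ w₂ l) ∧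
    ((∃ l : Fin d → ℝ, WRDMFT.LevelTwoConstraints N w₁ l ∧
        ¬ WRDMFT.LevelThreeConstraint N w₁ w₂ l) ↔ w₂ < w₁ ∧ 0 < w₃) := by
  -- Writing `N = m + 2` turns `N - 1` and `N - 2` into `m + 1` and `m`, free of truncated
  -- subtraction.
  obtain ⟨m, rfl⟩ := Nat.exists_eq_add_of_le' hN
  have hpoly := WRDMFT.spectralPolytope_eq_convexHull hd h₁₂ h₂₃ h₃ hsum
  refine ⟨hpoly, ?_, fun hw₃ hmem => ?_, fun h hh => ⟨WRDMFT.isLowestThree_configA hd hh,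
      WRDMFT.isLowestThree_configB hd hh⟩, fun h hh i₁ i₂ i₃ => WRDMFT.eq_of_isLowestThree hd hh,
    WRDMFT.exists_energy_configA_lt hd, WRDMFT.exists_energy_configB_lt hd,
    fun h _ i₁ i₂ i₃ hi => ⟨WRDMFT.configMixture_mem_ensemble h₁₂ h₂₃ h₃ hsum hi.1 hi.2.1
      hi.2.2.1, WRDMFT.isMinOn_oneBodyEnergy h₁₂ h₂₃ h₃ hi⟩, ?_, ?_, fun l => ?_, ?_⟩
  · exact (congrArg (Set.extremePoints ℝ) hpoly).trans
      (WRDMFT.extremePoints_convexHull_vertices hd h₁₂ h₂₃ h₃ hsum)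
  · exact WRDMFT.vertex₂_notMem_convexHull hd h₁₂ h₂₃ hw₃ hsum (subset_convexHull ℝ _ hmem)
  · rw [WRDMFT.oneRDM_configMixture, WRDMFT.mixtureOccupation_configA hd hsum]
  · rw [WRDMFT.oneRDM_configMixture, WRDMFT.mixtureOccupation_configB hd hsum]
  · exact (Set.ext_iff.mp hpoly l).trans
      ⟨WRDMFT.constraints_of_mem_convexHull hd h₁₂ h₂₃ h₃ hsum, fun hl =>
        WRDMFT.mem_convexHull_of_constraints hd hsum h₃ hl.1 hl.2⟩
  · constructor
    · rintro ⟨l, hl, hl'⟩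
      constructor
      · exact lt_of_le_of_ne h₁₂ fun h =>
          hl' (WRDMFT.levelThreeConstraint_of_levelTwo hd hsum (Or.inl h) hl)
      · exact lt_of_le_of_ne h₃ fun h =>
          hl' (WRDMFT.levelThreeConstraint_of_levelTwo hd hsum (Or.inr h.symm) hl)
    · rintro ⟨hw, hw₃⟩
      exact WRDMFT.exists_not_levelThreeConstraint hd h₂₃ hsum hw hw₃
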